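/- Let $V\subset V'$ be an immediate extension of valuation rings, that is, a local inclusion which induces isomorphisms of the value groups and of the residue fields. Let $K\subset K'$ be the fraction fields and let $\mathrm{val}$ denote the (additively written) valuation, with $\mathrm{val}(0)=\infty$ and value group $\Gamma$. Let $\lambda$ be a limit ordinal and $v=(v_i)_{i<\lambda}$ a sequence in $V$ such that - $v$ is pseudo-convergent: $\mathrm{val}(v_i-v_{i''})<\mathrm{val}(v_{i'}-v_{i''})$ for all $i<i'<i''<\lambda$; - $v$ is not fundamental: it is not true that for every $\gamma\in\Gamma$ one has $\mathrm{val}(v_i-v_{i'})>\gamma$ for all large enough $i<i'<\lambda$; - $v$ has no pseudo limit in $K$, where a pseudo limit of $v$ is an element $z$ with $\mathrm{val}(z-v_i)=\mathrm{val}(v_i-v_{i'})$ for all $i<i'<\lambda$. Let $x\in V'$ be a pseudo limit of $v$ such that $x$ is transcendental over $K$ and $K'=K(x)$. Assume that either $\dim V=1$ (Krull dimension) or $V$ is Henselian. Then the following statements are equivalent: 1. for every polynomial $f\in V[X]$ with $f(x)\neq 0$ there exists $y\in V$ such that $\mathrm{val}(f(y))=\mathrm{val}(f(x))$; 2. for every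 polynomial $f\in V[X]$ with $f(x)\neq 0$ there exists $y\in V$ such that $\mathrm{val}(f(y))\geq\mathrm{val}(f(x))$; 3. $v$ is transcendental: for every $f\in V[T]$ one has $\mathrm{val}(f(v_i))=\mathrm{val}(f(v_{i'}))$ for all large enough $i<i'<\lambda$; 4. $V'$ is a filtered union of localizations of polynomial $V$-subalgebras in one variable, that is, the union of a nonempty directed (under inclusion) family of $V$-subalgebras of $V'$, each of which is a localization of a subalgebra $V[u]\subset V'$ with $u$ transcendental over $V$, at some multiplicative system. -/

import Mathlib

open Polynomial

universe u₁ u₂ u₃ u₄ w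

/-- `V ⊆ V'` (with fraction fields `K ⊆ K'`) is an immediate extension of valuation rings: it is an
inclusion, it is local, and it induces isomorphisms of the value groups and of the residue fields.
The value groups are written multiplicatively and with a zero adjoined, as usual in Mathlib. -/
structure IsImmediateExtension (V : Type u₁) (V' : Type u₂) (K : Type u₃) (K' : Type u₄)
    [CommRing V] [IsDomain V] [ValuationRing V]
    [CommRing V'] [IsDomain V'] [ValuationRing V']
    [Field K] [Field K'] [Algebra V K] [IsFractionRing V K] [Algebra V' K'] [IsFractionRing V' K']
    [Algebra V V'] [Algebra K K'] : Prop where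
  injective : Function.Injective (algebraMap V V')
  isLocalHom : IsLocalHom (algebraMap V V')
  valueGroup : ∃ e : ValuationRing.ValueGroup V K ≃*o ValuationRing.ValueGroup V' K',
    ∀ a : K, e (ValuationRing.valuation V K a) =
      ValuationRing.valuation V' K' (algebraMap K K' a)
  residueField : Function.Bijective (IsLocalRing.ResidueField.map (algebraMap V V'))

section Sequences

variable {F : Type u₁} {Γ : Type u₂} [Field F] [LinearOrderedCommGroupWithZero Γ]

/-- A sequence indexed by the ordinals `i < o` is pseudo convergent for the valuation `val`.
Mathlib's valuations are multiplicative, so all inequalities are reversed with respect to the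
additive notation. -/
def IsPseudoConvergent (val : Valuation F Γ) {o : Ordinal.{w}} (v : Set.Iio o → F) : Prop :=
  ∀ i i' i'' : Set.Iio o, i < i' → i' < i'' → val (v i' - v i'') < val (v i - v i'')

/-- `x` is a pseudo limit of the sequence `v`. -/
def IsPseudoLimit (val : Valuation F Γ) {o : Ordinal.{w}} (v : Set.Iio o → F) (x : F) : Prop :=
  ∀ i i' : Set.Iio o, i < i' → val (x - v i) = val (v i - v i')

/-- The sequence `v` is fundamental: the differences `v i - v i'` eventually have (additive)
value larger than any given element of the value group. -/
def IsFundamental (val : Valuation F Γ) {o : Ordinal.{w}} (v : Set.Iio o → F) : Prop :=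
  ∀ γ : Γ, γ ≠ 0 → ∃ j : Set.Iio o, ∀ i i' : Set.Iio o, j ≤ i → i < i' → val (v i - v i') < γ

/-- A sequence `v` of elements of a ring `V` of coefficients in the valued field `F` is
transcendental: for each polynomial `f` over `V` the value of `f (v i)` is eventually constant. -/
def IsTranscendentalSeq (V : Type u₃) [CommRing V] [Algebra V F] (val : Valuation F Γ)
    {o : Ordinal.{w}} (v : Set.Iio o → V) : Prop :=
  ∀ f : V[X], ∃ j : Set.Iio o, ∀ i i' : Set.Iio o, j ≤ i → i < i' →
    val (algebraMap V F (f.eval (v i))) = val (algebraMap V F (f.eval (v i')))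

end Sequences

section FilteredUnion

variable {V : Type u₁} {B : Type u₂} [CommRing V] [CommRing B] [Algebra V B]

/-- `A` is a polynomial `V`-subalgebra in one variable of `B`. -/
def IsPolynomialSubalgebra (A : Subalgebra V B) : Prop :=
  ∃ u : B, Transcendental V u ∧ A = Algebra.adjoin V {u}

/-- The subalgebra `C` of `B` contains the subalgebra `A` and is a localization of `A` at some
multiplicative system. -/
def IsLocalizationOfSubalgebra (A C : Subalgebra V B) : Prop :=
  ∃ (h : A ≤ C) (S : Submonoid A),
    letI : Algebra A C := (Subalgebra.inclusion h).toRingHom.toAlgebra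
    IsLocalization S C

variable (V B) in
/-- `B` is a filtered union of subalgebras that are localizations of polynomial `V`-subalgebras
of `B` in one variable. -/
def IsFilteredUnionOfLocalizedPolynomial : Prop :=
  ∃ 𝓕 : Set (Subalgebra V B), 𝓕.Nonempty ∧ DirectedOn (· ≤ ·) 𝓕 ∧
    (∀ C ∈ 𝓕, ∃ A : Subalgebra V B, IsPolynomialSubalgebra A ∧ IsLocalizationOfSubalgebra A C) ∧
    ∀ b : B, ∃ C ∈ 𝓕, b ∈ C

end FilteredUnion

/-!
Write `γ i` for the value of `x - v i`; it is strictly monotone in `i`. The equivalence is proved as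
the cycle transcendental sequence ⟹ filtered union ⟹ equality of values ⟹ inequality of values ⟹
transcendental sequence. Valuations are multiplicative throughout, so "closer" means "smaller".

*Taylor expansions.* Let `f` be a polynomial all of whose Hasse derivatives of positive order have
eventually constant value along `v`. In `f x - f (v i) = ∑ D_k f (v i) (x - v i) ^ k` the term of
degree `k` has value `c_k γ i ^ k` for large `i`, and two such terms of different degrees can change
order only once; so eventually one term dominates strictly (`exists_dominant_term`) and
`f x - f (v i)` has its value (`Valuation.exists_map_eval_sub_eq`). Consequently, if the value of
`f (v i)` is eventually constant, then it is larger than that of every other term of the expansion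
(`Valuation.map_hasseDeriv_mul_lt_of_eventuallyConst`), and otherwise the value of `f x` is smaller
than that of all late `f (v i)` (`Valuation.map_eval_lt_of_not_eventuallyConst`).

*From transcendental sequences to filtered unions.* Put `x - v i = d i * u i` with `d i ∈ V` and
`u i` a unit of `V'`. The subalgebras `V[u i]` form a chain. For a transcendental sequence the
expansion of `f` reads `f x = f (v i) (1 + ∑ e_k (u i) ^ k)` with `e_k` in the maximal ideal, so
`f x` is a constant times a unit of `V'` in `V[u i]`. As `V'` lies in `K(x)`, it is the union of the
localizations of the `V[u i]` at the elements invertible in `V'`.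

*From filtered unions to values.* A localization `C ⊆ V'` of `V[u]` has a `V`-algebra map to `V`:
evaluate at an element of `V` with the residue of `u`
(`IsLocalizationOfSubalgebra.nonempty_algHom`). Since `f x` is associated to some `d ∈ V`, a member
`C` of the family containing `x` and the unit `f x / d` together with its inverse maps `x` to an
element `y` with `f y` associated to `d`.

*From values to transcendental sequences.* Otherwise take `f` of least degree such that the value of
`f (v i)` is not eventually constant. Then `f x`, hence by assumption some `f y` with `y ∈ V`, is
smaller than all late `f (v i)`, although `y` is not a pseudo limit, i.e. stays at a constant
distance from `v`. If `V` is Henselian, this is impossible since `f` is irreducible over `K`: the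
integral closure of `V` in a Galois extension of `K` is local
(`IsLocalRing.of_isInvariant_of_henselian`), hence a valuation ring stable under the Galois group,
so all roots of `f` are equally far from any given element of `K`; whichever of `y` and `v i` is
farther from one root is farther from all of them. If `V` has dimension one, an affine substitution
turns `y` into `0` and `v i` into elements of residue `1`, and scaling gives a primitive polynomial
whose reduction vanishes at `0` and at `1`. The factorization of the reduction into a power of
`X - 1` and a factor not vanishing at `1` lifts modulo any power of an element of the maximal ideal
(`Polynomial.exists_factorization_mod_pow`), and these powers become smaller than all `f (v i)`.
The first factor has lower degree than `f` and up to a constant the same values along `v`,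
contradicting minimality.
-/

/-! ### Values of polynomials along a pseudo convergent sequence -/

section Kaplansky

open Filter

variable {ι : Type*} [LinearOrder ι] [Nonempty ι]

/-- Monomials `c_k γ i ^ k` of different degrees in a strictly decreasing `γ` change their order at
most once, so one of finitely many eventually exceeds all others. -/
theorem exists_dominant_term [NoMaxOrder ι] {Γ : Type*} [LinearOrderedCommGroupWithZero Γ]
    {γ : ι → Γ} (hγ : StrictAnti γ) {S : Finset ℕ} (hS : S.Nonempty) {t : ℕ → ι → Γ}
    (ht : ∀ k ∈ S, ∃ c ≠ 0, ∀ᶠ i in atTop, t k i = c * γ i ^ k) :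
    ∃ k ∈ S, ∀ l ∈ S, l ≠ k → ∀ᶠ i in atTop, t l i < t k i := by
  have hγ0 : ∀ i, 0 < γ i := fun i => by
    obtain ⟨j, hj⟩ := exists_gt i
    exact lt_of_le_of_lt zero_le (hγ hj)
  -- two terms of different degrees are eventually strictly ordered
  have key : ∀ k ∈ S, ∀ l ∈ S, k < l →
      (∀ᶠ i in atTop, t l i < t k i) ∨ (∀ᶠ i in atTop, t k i < t l i) := by
    intro k hk l hl hkl
    obtain ⟨c, hc, hkc⟩ := ht k hk
    obtain ⟨d, hd, hld⟩ := ht l hl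
    obtain ⟨m, rfl⟩ : ∃ m, l = k + (m + 1) := ⟨l - k - 1, by omega⟩
    by_cases h : ∃ i, d * γ i ^ (m + 1) ≤ c
    · obtain ⟨i, hi⟩ := h
      left
      filter_upwards [hkc, hld, eventually_gt_atTop i] with j h1 h2 hij
      have h3 : d * γ j ^ (m + 1) < c := lt_of_lt_of_le
        (mul_lt_mul_of_pos_left (pow_lt_pow_left₀ (hγ hij) zero_le (Nat.succ_ne_zero m))
          (zero_lt_iff.2 hd)) hi
      rw [h1, h2, pow_add, mul_left_comm, mul_comm c]
      exact mul_lt_mul_of_pos_left h3 (pow_pos (hγ0 j) k)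
    · push Not at h
      right
      filter_upwards [hkc, hld] with j h1 h2
      rw [h1, h2, pow_add, mul_left_comm, mul_comm c]
      exact mul_lt_mul_of_pos_left (h j) (pow_pos (hγ0 j) k)
  have key' : ∀ k ∈ S, ∀ l ∈ S, k ≠ l →
      (∀ᶠ i in atTop, t l i < t k i) ∨ (∀ᶠ i in atTop, t k i < t l i) := by
    intro k hk l hl hkl
    rcases lt_or_gt_of_ne hkl with h | h
    · exact key k hk l hl h
    · exact (key l hl k hk h).symm
  clear key ht
  induction hS using Finset.Nonempty.cons_induction with
  | singleton a => exact ⟨a, by simp, by simp⟩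
  | cons a S ha hS ih =>
    obtain ⟨k, hk, hmax⟩ := ih fun k hk l hl => key' k (by simp [hk]) l (by simp [hl])
    have hak : a ≠ k := by rintro rfl; exact ha hk
    rcases key' a (by simp) k (by simp [hk]) hak with h | h
    · refine ⟨a, by simp, fun l hl hla => ?_⟩
      have hlS : l ∈ S := by simpa [hla] using hl
      by_cases hlk : l = k
      · rwa [hlk]
      · filter_upwards [h, hmax l hlS hlk] with i h1 h2 using h2.trans h1
    · refine ⟨k, by simp [hk], fun l hl hlk => ?_⟩
      rcases Finset.mem_cons.1 hl with rfl | hlS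
      · exact h
      · exact hmax l hlS hlk

variable {F Γ : Type*} [Field F] [LinearOrderedCommGroupWithZero Γ] {val : Valuation F Γ}

/-- If the Hasse derivatives of `f` of positive order have eventually constant values along `a`, then
a single term of the Taylor expansion at `a i` eventually determines the value of
`f x - f (a i)` and bounds all other terms. -/
theorem Valuation.exists_map_eval_sub_eq [NoMaxOrder ι] {a : ι → F} {x : F}
    (hγ : StrictAnti fun i => val (x - a i)) {f : F[X]} (hf : f.natDegree ≠ 0)
    (hconst : ∀ k ≠ 0, EventuallyConst (fun i => val ((hasseDeriv k f).eval (a i))) atTop) :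
    ∃ c ≠ 0, ∃ k ≠ 0, (∀ᶠ i in atTop, val (f.eval x - f.eval (a i)) = c * val (x - a i) ^ k) ∧
      ∀ᶠ i in atTop, ∀ l ≠ 0,
        val ((hasseDeriv l f).eval (a i) * (x - a i) ^ l) ≤ c * val (x - a i) ^ k := by
  classical
  have hγ0 : ∀ i, 0 < val (x - a i) := fun i => by
    obtain ⟨j, hj⟩ := exists_gt i
    exact lt_of_le_of_lt zero_le (hγ hj)
  have hc : ∀ k, ∃ c, k ≠ 0 → ∀ᶠ i in atTop, val ((hasseDeriv k f).eval (a i)) = c := by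
    intro k
    by_cases hk : k = 0
    · exact ⟨0, fun h => absurd hk h⟩
    · obtain ⟨c, hc⟩ := eventuallyConst_iff_exists_eventuallyEq.1 (hconst k hk)
      exact ⟨c, fun _ => hc⟩
  choose c hc using hc
  set t : ℕ → ι → Γ := fun k i => val ((hasseDeriv k f).eval (a i) * (x - a i) ^ k) with ht
  set S : Finset ℕ := (Finset.Icc 1 f.natDegree).filter fun k => c k ≠ 0 with hS
  have hmem : ∀ k, k ∈ S ↔ (1 ≤ k ∧ k ≤ f.natDegree) ∧ c k ≠ 0 := by simp [hS]
  have htop : f.natDegree ∈ S := by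
    refine (hmem _).2 ⟨⟨Nat.one_le_iff_ne_zero.2 hf, le_rfl⟩, fun h0 => ?_⟩
    obtain ⟨i, hi⟩ := (hc _ hf).exists
    rw [h0, ← taylor_coeff, coeff_taylor_natDegree, map_eq_zero, leadingCoeff_eq_zero] at hi
    exact hf (by simp [hi])
  have htS : ∀ k ≠ 0, ∀ᶠ i in atTop, t k i = c k * val (x - a i) ^ k := fun k hk => by
    filter_upwards [hc k hk] with i hi
    simp only [ht, map_mul, map_pow, hi]
  obtain ⟨k, hkS, hkmax⟩ := exists_dominant_term hγ ⟨_, htop⟩ (t := t) fun k hk =>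
    ⟨c k, ((hmem k).1 hk).2, htS k (by have := ((hmem k).1 hk).1.1; omega)⟩
  have hk0 : k ≠ 0 := by have := ((hmem k).1 hkS).1.1; omega
  have hck : c k ≠ 0 := ((hmem k).1 hkS).2
  have hlt : ∀ᶠ i in atTop, ∀ l ∈ Finset.Icc 1 f.natDegree, l ≠ k → t l i < t k i := by
    rw [Filter.eventually_all_finset]
    intro l hl
    by_cases hlk : l = k
    · simp [hlk]
    by_cases hcl : c l = 0
    · filter_upwards [htS k hk0, htS l (by have := (Finset.mem_Icc.1 hl).1; omega)] with i h1 h2 _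
      rw [h1, h2, hcl, zero_mul]
      exact mul_pos (zero_lt_iff.2 hck) (pow_pos (hγ0 i) k)
    · filter_upwards [hkmax l ((hmem l).2 ⟨Finset.mem_Icc.1 hl, hcl⟩) hlk] with i hi _ using hi
  refine ⟨c k, hck, k, hk0, ?_, ?_⟩
  · filter_upwards [hlt, htS k hk0] with i hi hik
    have hexp : f.eval x - f.eval (a i) =
        ∑ l ∈ Finset.Icc 1 f.natDegree, (hasseDeriv l f).eval (a i) * (x - a i) ^ l := by
      rw [← taylor_eval_sub (a i) f x, eval_eq_sum_range, natDegree_taylor,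
        Finset.range_eq_Ico, Finset.sum_eq_sum_Ico_succ_bot (Nat.succ_pos _)]
      simp only [taylor_coeff, hasseDeriv_zero', pow_zero, mul_one, add_sub_cancel_left]
      rfl
    rw [hexp, ← hik]
    have hkI : k ∈ Finset.Icc 1 f.natDegree := Finset.mem_Icc.2 ((hmem k).1 hkS).1
    rw [← Finset.add_sum_erase _ _ hkI]
    refine val.map_add_eq_of_lt_left ?_
    refine val.map_sum_lt ?_ fun l hl => ?_
    · show t k i ≠ 0
      rw [hik]
      exact mul_ne_zero hck (pow_ne_zero _ (hγ0 i).ne')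
    · exact hi l (Finset.mem_of_mem_erase hl) (Finset.ne_of_mem_erase hl)
  · filter_upwards [hlt, htS k hk0] with i hi hik l hl
    rw [← hik]
    show t l i ≤ t k i
    by_cases hln : l ≤ f.natDegree
    · by_cases hlk : l = k
      · rw [hlk]
      · exact (hi l (Finset.mem_Icc.2 ⟨Nat.one_le_iff_ne_zero.2 hl, hln⟩) hlk).le
    · simp [ht, ← taylor_coeff, coeff_eq_zero_of_natDegree_lt
        ((natDegree_taylor f (a i)).trans_lt (not_le.1 hln))]

/-- The value of `f x - f (a i)` is eventually strictly decreasing. If it ever were at most that of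
`f x`, then `f (a i)` would have the value of `f x` from there on. -/
theorem Valuation.map_eval_lt_of_not_eventuallyConst [NoMaxOrder ι] {a : ι → F} {x : F}
    (hγ : StrictAnti fun i => val (x - a i)) {f : F[X]}
    (hconst : ∀ k ≠ 0, EventuallyConst (fun i => val ((hasseDeriv k f).eval (a i))) atTop)
    (hf : ¬ EventuallyConst (fun i => val (f.eval (a i))) atTop) :
    ∀ᶠ i in atTop, val (f.eval x) < val (f.eval (a i)) := by
  have hdeg : f.natDegree ≠ 0 := fun h => hf <| by
    rw [eq_C_of_natDegree_eq_zero h]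
    simp [EventuallyConst.const]
  obtain ⟨c, hc, k, hk, heq, -⟩ := Valuation.exists_map_eval_sub_eq hγ hdeg hconst
  have hanti : ∀ i j, i < j → c * val (x - a j) ^ k < c * val (x - a i) ^ k := fun i j hij =>
    mul_lt_mul_of_pos_left (pow_lt_pow_left₀ (hγ hij) zero_le hk) (zero_lt_iff.2 hc)
  have hlt : ∀ i, val (f.eval x) < c * val (x - a i) ^ k := by
    intro i
    by_contra! hi
    refine hf (eventuallyConst_iff_exists_eventuallyEq.2 ⟨val (f.eval x), ?_⟩)
    filter_upwards [heq, eventually_gt_atTop i] with j hj hij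
    have := val.map_sub_eq_of_lt_right (x := f.eval x - f.eval (a j)) (y := f.eval x)
      (by rw [hj]; exact (hanti i j hij).trans_le hi)
    simpa using this
  filter_upwards [heq] with i hi
  have := val.map_sub_eq_of_lt_right (x := f.eval x) (y := f.eval x - f.eval (a i))
    (by rw [hi]; exact hlt i)
  simp only [sub_sub_cancel] at this
  rw [this, hi]
  exact hlt i

/-- When `f (a i)` also has eventually constant value, its value exceeds that of each further term of
the Taylor expansion at `a i`: otherwise `f x - f (a i)`, whose value is eventually strictly
decreasing, would have the value of `f x` for all large `i`. -/
theorem Valuation.map_hasseDeriv_mul_lt_of_eventuallyConst [NoMaxOrder ι] {a : ι → F} {x : F}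
    (hγ : StrictAnti fun i => val (x - a i)) {f : F[X]} (hf0 : f ≠ 0)
    (hconst : ∀ k, EventuallyConst (fun i => val ((hasseDeriv k f).eval (a i))) atTop) :
    ∀ᶠ i in atTop, f.eval (a i) ≠ 0 ∧ ∀ l ≠ 0,
      val ((hasseDeriv l f).eval (a i) * (x - a i) ^ l) < val (f.eval (a i)) := by
  by_cases hdeg : f.natDegree = 0
  · rw [eq_C_of_natDegree_eq_zero hdeg] at hf0 ⊢
    refine Eventually.of_forall fun i => ⟨by simpa using hf0, fun l hl => ?_⟩
    rw [hasseDeriv_C _ _ (Nat.pos_of_ne_zero hl)]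
    simpa [zero_lt_iff] using hf0
  obtain ⟨c, hc, k, hk, heq, hle⟩ := Valuation.exists_map_eval_sub_eq hγ hdeg fun k _ => hconst k
  have hanti : ∀ i j, i < j → c * val (x - a j) ^ k < c * val (x - a i) ^ k := fun i j hij =>
    mul_lt_mul_of_pos_left (pow_lt_pow_left₀ (hγ hij) zero_le hk) (zero_lt_iff.2 hc)
  obtain ⟨b, hb⟩ := eventuallyConst_iff_exists_eventuallyEq.1 (hconst 0)
  simp only [hasseDeriv_zero'] at hb
  obtain ⟨i₀, hi₀⟩ := eventually_atTop.1 (heq.and hb)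
  have hle' : ∀ i ≥ i₀, c * val (x - a i) ^ k ≤ b := by
    intro i hi
    by_contra! hlt
    have hx : ∀ j ≥ i₀, b < c * val (x - a j) ^ k → val (f.eval x) = c * val (x - a j) ^ k := by
      intro j hj hbj
      have := val.map_add_eq_of_lt_right (x := f.eval (a j)) (y := f.eval x - f.eval (a j))
        (by rw [(hi₀ j hj).1]; exact (hi₀ j hj).2.trans_lt hbj)
      rwa [add_sub_cancel, (hi₀ j hj).1] at this
    obtain ⟨j, hj⟩ := exists_gt i
    have h1 := hx i hi hlt
    have h2 := (hi₀ j (hi.trans hj.le)).1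
    -- the value of `f x - f (a j)` would be the constant value of `f x`
    have h3 : val (f.eval x - f.eval (a j)) = val (f.eval x) :=
      val.map_sub_eq_of_lt_left (by rw [h1]; exact (hi₀ j (hi.trans hj.le)).2.trans_lt hlt)
    exact (hanti i j hj).ne (h2.symm.trans (h3.trans h1))
  filter_upwards [hle, hb, eventually_gt_atTop i₀] with i h1 h2 h3
  have hlt : c * val (x - a i) ^ k < b := (hanti _ _ h3).trans_le (hle' _ le_rfl)
  refine ⟨fun h => ?_, fun l hl => ?_⟩
  · have h4 : val (f.eval (a i)) = b := h2
    rw [h, map_zero] at h4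
    rw [← h4] at hlt
    exact not_lt_zero hlt
  · exact ((h1 l hl).trans_lt hlt).trans_eq h2.symm

end Kaplansky

/-! ### Galois-invariant valuations over a Henselian valuation ring -/

section ValuationRing

variable {V : Type*} [CommRing V] [IsDomain V] [ValuationRing V]

/-- Over a valuation ring, dividing by a coefficient of largest value makes a polynomial
primitive. -/
theorem ValuationRing.exists_eq_C_mul {f : V[X]} (hf : f ≠ 0) :
    ∃ s ∈ Set.range f.coeff, s ≠ 0 ∧ ∃ g : V[X], f = C s * g ∧ ∃ j, g.coeff j = 1 := by
  have hne : f.support.Nonempty := support_nonempty.2 hf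
  have key : ∀ S : Finset ℕ, S.Nonempty → ∃ j ∈ S, ∀ l ∈ S, f.coeff j ∣ f.coeff l := by
    intro S hS
    induction hS using Finset.Nonempty.cons_induction with
    | singleton a => exact ⟨a, by simp, by simp⟩
    | cons a S ha hS ih =>
      obtain ⟨k, hk, hmin⟩ := ih
      rcases ValuationRing.dvd_total (f.coeff a) (f.coeff k) with h | h
      · exact ⟨a, by simp, by simpa using fun l hl => h.trans (hmin l hl)⟩
      · refine ⟨k, by simp [hk], fun l hl => ?_⟩
        rcases Finset.mem_cons.1 hl with rfl | hl
        exacts [h, hmin l hl]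
  obtain ⟨j, hj, hmin⟩ := key _ hne
  have hj0 : f.coeff j ≠ 0 := mem_support_iff.1 hj
  have hdvd : C (f.coeff j) ∣ f := by
    rw [C_dvd_iff_dvd_coeff]
    intro l
    by_cases hl : l ∈ f.support
    · exact hmin l hl
    · simp [notMem_support_iff.1 hl]
  obtain ⟨g, hg⟩ := hdvd
  refine ⟨_, ⟨j, rfl⟩, hj0, g, hg, j, ?_⟩
  have := congrArg (coeff · j) hg
  simp only [coeff_C_mul] at this
  exact mul_left_cancel₀ hj0 (by rw [← this, mul_one])

end ValuationRing

section Henselian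

/-- An element of a field which is a root of a polynomial with a unit coefficient over an integrally
closed local subring lies in this subring, or its inverse does. -/
theorem mem_range_or_inv_mem_range_of_isUnit_coeff {B L : Type*} [CommRing B] [IsLocalRing B]
    [Field L] [Algebra B L] [IsIntegrallyClosedIn B L] {t : L} {p : B[X]} (hp : aeval t p = 0)
    (hu : ∃ j, IsUnit (p.coeff j)) :
    t ∈ (algebraMap B L).range ∨ t⁻¹ ∈ (algebraMap B L).range := by
  have hinj : Function.Injective (algebraMap B L) :=
    (isIntegrallyClosedIn_iff.1 ‹_›).1
  induction hn : p.natDegree using Nat.strong_induction_on generalizing p with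
  | _ n ih =>
  by_cases hn0 : n = 0
  · subst hn0
    obtain ⟨j, hj⟩ := hu
    rw [eq_C_of_natDegree_eq_zero hn] at hp hj
    rw [aeval_C, map_eq_zero_iff _ hinj] at hp
    simp [hp] at hj
  obtain ⟨m, rfl⟩ : ∃ m, n = m + 1 := ⟨n - 1, by omega⟩
  obtain ⟨b, hb⟩ : ∃ b : B, algebraMap B L b = p.leadingCoeff • t :=
    IsIntegrallyClosedIn.isIntegral_iff.1 (isIntegral_leadingCoeff_smul p t hp)
  rw [Algebra.smul_def] at hb
  obtain ⟨j, hj⟩ := hu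
  by_cases hlc : IsUnit p.leadingCoeff
  · left
    obtain ⟨c, hc⟩ := hlc.exists_left_inv
    exact ⟨c * b, by rw [map_mul, hb, ← mul_assoc, ← map_mul, hc, map_one, one_mul]⟩
  have hjn : j ≠ m + 1 := by
    rintro rfl
    exact hlc (by rwa [leadingCoeff, hn])
  -- absorb the top term `leadingCoeff * t ^ (m + 1)` into the coefficient of `t ^ m`
  set q : B[X] := p.eraseLead + C b * X ^ m with hq
  have hqdeg : q.natDegree ≤ m := natDegree_add_le_of_degree_le
    ((eraseLead_natDegree_le p).trans (by omega)) (natDegree_C_mul_X_pow_le _ _)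
  have hq0 : aeval t q = 0 := by
    have h1 := congrArg (aeval t) (eraseLead_add_C_mul_X_pow p)
    rw [hp, hn] at h1
    simp only [map_add, map_mul, aeval_C, map_pow, aeval_X] at h1
    simp only [hq, map_add, map_mul, aeval_C, map_pow, aeval_X]
    rw [← h1, pow_succ, hb]
    ring
  have hqj : q.coeff j = p.coeff j + (if j = m then b else 0) := by
    rw [hq, coeff_add, eraseLead_coeff_of_ne _ (by rw [hn]; exact hjn), coeff_C_mul_X_pow]
  by_cases hqu : IsUnit (q.coeff j)
  · exact ih _ (by omega) hq0 ⟨j, hqu⟩ rfl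
  · rw [hqj] at hqu
    split_ifs at hqu with hjm
    · right
      have hbu : IsUnit b := by
        by_contra hb'
        have h1 : b ∈ IsLocalRing.maximalIdeal B := hb'
        have h2 : p.coeff j + b ∈ IsLocalRing.maximalIdeal B := hqu
        exact ((IsLocalRing.maximalIdeal B).add_mem_iff_left h1).1 h2 hj
      obtain ⟨c, hc⟩ := hbu.exists_left_inv
      refine ⟨c * p.leadingCoeff, eq_inv_of_mul_eq_one_left ?_⟩
      rw [map_mul, mul_assoc, ← hb, ← map_mul, hc, map_one]
    · exact absurd hj (by simpa using hqu)

open IsLocalRing Pointwise in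
/-- If two maximal ideals were conjugate but different, a product of translates would give an element
`α`, fixed by the stabilizer of `M`, with `α ≡ 1` modulo `M` and `α ≡ 0` modulo the other
conjugates of `M`. The polynomial of its conjugates has coefficients in `V` and the simple root `1`
modulo `M`, so `α` would lie in `V`. -/
theorem IsLocalRing.of_isInvariant_of_henselian {V B : Type*} (G : Type*) [CommRing V] [CommRing B]
    [IsDomain B] [Algebra V B] [Group G] [Finite G] [MulSemiringAction G B] [SMulCommClass G V B]
    [Algebra.IsInvariant V B G] [HenselianLocalRing V] : IsLocalRing B := by
  classical
  cases nonempty_fintype G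
  have hint : Algebra.IsIntegral V B := Algebra.IsInvariant.isIntegral V B G
  have hunder : ∀ M : Ideal B, M.IsMaximal → M.under V = maximalIdeal V := fun M hM =>
    eq_maximalIdeal (Ideal.isMaximal_comap_of_isIntegral_of_isMaximal M)
  obtain ⟨M, hM⟩ := Ideal.exists_maximal B
  suffices hfix : ∀ g : G, g • M = M by
    refine IsLocalRing.of_unique_max_ideal ⟨M, hM, fun M' hM' => ?_⟩
    obtain ⟨g, hg⟩ := Algebra.IsInvariant.exists_smul_of_under_eq V B G M M'
      ((hunder M hM).trans (hunder M' hM').symm)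
    rw [hg, hfix]
  intro g₀
  by_contra hg₀
  -- the Chinese remainder theorem gives a first approximation to `α`
  obtain ⟨β, hβM, hβ⟩ : ∃ β : B, 1 - β ∈ M ∧ ∀ g : G, g • M ≠ M → β ∈ g • M := by
    have hJ : ¬ (Finset.univ.filter fun g : G => g • M ≠ M).inf (fun g => g • M) ≤ M := by
      rw [hM.isPrime.inf_le']
      rintro ⟨g, hg, hle⟩
      have hgM : (g • M).IsMaximal := by
        have := Ideal.map_isMaximal_of_equiv (MulSemiringAction.toRingEquiv G B g) (p := M)
        exact this
      exact (Finset.mem_filter.1 hg).2 (hgM.eq_of_le hM.ne_top hle)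
    obtain ⟨b, hbJ, hbM⟩ := SetLike.not_le_iff_exists.1 hJ
    obtain ⟨y, i, hi, hyi⟩ := hM.exists_inv hbM
    refine ⟨y * b, by rw [← hyi, add_sub_cancel_left]; exact hi, fun g hg => ?_⟩
    exact Ideal.mul_mem_left _ _ ((Finset.inf_le (f := fun g : G => g • M)
      (Finset.mem_filter.2 ⟨Finset.mem_univ g, hg⟩)) hbJ)
  set α : B := ∏ g : MulAction.stabilizer G M, (g : G) • β with hα
  have hαM : 1 - α ∈ M := by
    rw [← Ideal.Quotient.eq, map_one, hα, map_prod]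
    refine (Finset.prod_eq_one fun g _ => ?_).symm
    rw [← map_one (Ideal.Quotient.mk M), eq_comm, Ideal.Quotient.eq]
    have h1 : (g : G) • (1 - β) ∈ (g : G) • M := Ideal.smul_mem_pointwise_smul _ _ _ hβM
    rwa [smul_sub, smul_one, MulAction.mem_stabilizer_iff.1 g.2] at h1
  have hαg : ∀ g : G, g • M ≠ M → α ∈ g • M := fun g hg => by
    rw [hα, ← Finset.mul_prod_erase _ _ (Finset.mem_univ 1)]
    refine Ideal.mul_mem_right _ _ ?_
    simpa using hβ g hg
  have hαfix : ∀ g : G, g • M = M → g • α = α := fun g hg => by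
    rw [hα, Finset.smul_prod']
    refine Fintype.prod_equiv (Equiv.mulLeft (⟨g, hg⟩ : MulAction.stabilizer G M)) _ _ fun x => ?_
    simp [mul_smul]
  have hα1 : ∀ g : G, g • α ≠ α → g • α ∈ M := fun g hg => by
    have h1 : g⁻¹ • M ≠ M := fun h => hg (hαfix g (by rw [← h, smul_inv_smul, h]))
    have := Ideal.smul_mem_pointwise_smul g _ _ (hαg _ h1)
    rwa [smul_inv_smul] at this
  -- the product of `X - c` over the distinct conjugates `c` of `α`
  set q := prodXSubSMul G B α with hq
  obtain ⟨h, hh, -, hmonic⟩ : ∃ h : V[X], h.map (algebraMap V B) = q ∧ h.degree = q.degree ∧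
      h.Monic := by
    refine lifts_and_degree_eq_and_monic ?_ (prodXSubSMul.monic G B α)
    rw [lifts_iff_coeff_lifts]
    exact fun n => Algebra.IsInvariant.isInvariant (G := G) _ fun g => prodXSubSMul.coeff G B α g n
  have hqr : ∃ r : B[X], q = (X - C α) * r ∧ r.eval 1 ∉ M := by
    rw [hq, prodXSubSMul, ← Finset.mul_prod_erase _ _ (Finset.mem_univ
      ((1 : G) : G ⧸ MulAction.stabilizer G α))]
    refine ⟨_, by rw [MulAction.ofQuotientStabilizer_mk, one_smul], ?_⟩
    rw [eval_prod, hM.isPrime.prod_mem_iff]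
    rintro ⟨c, hc, hcM⟩
    obtain ⟨g, rfl⟩ := QuotientGroup.mk_surjective c
    have hgα : g • α ≠ α := fun hgα => Finset.ne_of_mem_erase hc
      (QuotientGroup.eq.2 ((Subgroup.mul_mem _ (Subgroup.inv_mem _ hgα) (Subgroup.one_mem _))))
    rw [MulAction.ofQuotientStabilizer_mk, eval_sub, eval_X, eval_C] at hcM
    exact hM.ne_top ((Ideal.eq_top_iff_one _).2 (by simpa using M.add_mem hcM (hα1 g hgα)))
  obtain ⟨r, hr, hrM⟩ := hqr
  have hmem : ∀ a : V, a ∈ maximalIdeal V ↔ algebraMap V B a ∈ M := fun a => by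
    rw [← hunder M hM]; rfl
  have hev : ∀ (p : V[X]) (a : V), algebraMap V B (p.eval a) =
      (p.map (algebraMap V B)).eval (algebraMap V B a) := fun p a => by
    rw [eval_map_algebraMap, aeval_algebraMap_apply, coe_aeval_eq_eval]
  obtain ⟨a, ha, -⟩ := HenselianLocalRing.is_henselian h hmonic 1
    (by rw [hmem, hev, hh, hr, map_one, eval_mul, eval_sub, eval_X, eval_C]
        exact M.mul_mem_right _ hαM)
    (by
      rw [← notMem_maximalIdeal, hmem, hev, ← derivative_map, hh, hr, map_one, derivative_mul,
        derivative_sub, derivative_X, derivative_C, sub_zero, one_mul, eval_add, eval_mul, eval_sub,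
        eval_X, eval_C]
      rwa [M.add_mem_iff_left (M.mul_mem_right _ hαM)])
  have hroot : q.eval (algebraMap V B a) = 0 := by rw [← hh, ← hev, ha.eq_zero, map_zero]
  obtain ⟨g, hg⟩ : ∃ g : G, algebraMap V B a = g • α := by
    rw [hq, prodXSubSMul, eval_prod, Finset.prod_eq_zero_iff] at hroot
    obtain ⟨c, -, hc⟩ := hroot
    obtain ⟨g, rfl⟩ := QuotientGroup.mk_surjective c
    rw [MulAction.ofQuotientStabilizer_mk, eval_sub, eval_X, eval_C, sub_eq_zero] at hc
    exact ⟨g, hc⟩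
  -- the root in `V` is `α` itself, which lies in a conjugate of `M` but not in `M`
  have hαa : α = algebraMap V B a := by
    rw [← smul_algebraMap g⁻¹ a, hg, inv_smul_smul]
  have h1 : a ∈ (g₀ • M).under V := by
    show algebraMap V B a ∈ g₀ • M
    rw [← hαa]; exact hαg g₀ hg₀
  have hg₀M : (g₀ • M).IsMaximal :=
    Ideal.map_isMaximal_of_equiv (MulSemiringAction.toRingEquiv G B g₀) (p := M)
  rw [hunder _ hg₀M, hmem, ← hαa] at h1
  exact hM.ne_top ((Ideal.eq_top_iff_one _).2 (by simpa using M.add_mem hαM h1))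

/-- A Henselian valuation ring extends to a Galois-stable valuation ring of each finite Galois
extension of its fraction field, namely its integral closure. -/
theorem ValuationRing.exists_valuationSubring_galois_invariant (V : Type*) {K L : Type*}
    [CommRing V] [IsDomain V] [ValuationRing V] [HenselianLocalRing V] [Field K] [Algebra V K]
    [IsFractionRing V K] [Field L] [Algebra K L] [FiniteDimensional K L] [IsGalois K L] :
    ∃ O : ValuationSubring L,
      (∀ a b : K, O.valuation (algebraMap K L a) ≤ O.valuation (algebraMap K L b) ↔
        ValuationRing.valuation V K a ≤ ValuationRing.valuation V K b) ∧
      ∀ (σ : L ≃ₐ[K] L) (t : L), O.valuation (σ t) = O.valuation t := by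
  algebraize [(algebraMap K L).comp (algebraMap V K)]
  have : IsFractionRing (integralClosure V L) L :=
    integralClosure.isFractionRing_of_finite_extension K L
  have : Finite (integralClosure V L ≃ₐ[V] integralClosure V L) :=
    Finite.of_equiv _ (galRestrict V K L (integralClosure V L)).toEquiv
  have := Algebra.isInvariant_of_isGalois' V K L (integralClosure V L)
  have hloc : IsLocalRing (integralClosure V L) := IsLocalRing.of_isInvariant_of_henselian (V := V)
    (integralClosure V L ≃ₐ[V] integralClosure V L)
  have hinv : ∀ t : L, IsIntegral V t ∨ IsIntegral V t⁻¹ := fun t => by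
    obtain ⟨p, hp0, hp⟩ := (IsFractionRing.isAlgebraic_iff V K L).2
      (Algebra.IsAlgebraic.isAlgebraic (R := K) t)
    obtain ⟨s, -, hs, g, rfl, j, hj⟩ := ValuationRing.exists_eq_C_mul hp0
    have hs' : algebraMap V L s ≠ 0 := by
      rw [IsScalarTower.algebraMap_apply V K L]
      simpa using hs
    rw [map_mul, aeval_C, mul_eq_zero_iff_left hs'] at hp
    have := mem_range_or_inv_mem_range_of_isUnit_coeff (B := integralClosure V L) (t := t)
      (p := g.map (algebraMap V (integralClosure V L))) (by rwa [aeval_map_algebraMap])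
      ⟨j, by simp [hj]⟩
    rcases this with ⟨b, hb⟩ | ⟨b, hb⟩
    · exact Or.inl (hb ▸ b.2)
    · exact Or.inr (hb ▸ b.2)
  let O : ValuationSubring L :=
    { (integralClosure V L).toSubring with mem_or_inv_mem' := hinv }
  have hO : ∀ t, O.valuation t ≤ 1 ↔ IsIntegral V t := fun t => O.valuation_le_one_iff t
  have hK : (O.valuation.comap (algebraMap K L)).IsEquiv (ValuationRing.valuation V K) := by
    refine Valuation.isEquiv_iff_val_le_one.2 fun {a} => ?_
    rw [Valuation.comap_apply, hO, isIntegral_algebraMap_iff (algebraMap K L).injective,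
      IsIntegrallyClosed.isIntegral_iff]
    exact (ValuationRing.mem_integer_iff V K a).symm
  refine ⟨O, fun a b => hK a b, fun σ t => ?_⟩
  have hσ : ∀ σ : L ≃ₐ[K] L, (O.valuation.comap (σ : L →+* L)).IsEquiv O.valuation := fun σ =>
    Valuation.isEquiv_iff_val_le_one.2 fun {a} => by
      rw [Valuation.comap_apply, hO, hO]
      exact isIntegral_algEquiv (σ.restrictScalars V)
  -- if `σ` changed the value of `t`, its iterates would do so strictly monotonically
  have hle : ∀ (σ : L ≃ₐ[K] L) (t : L), O.valuation t ≤ O.valuation (σ t) := by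
    intro σ t
    by_contra! hlt
    have hiter : ∀ n : ℕ, O.valuation ((σ ^ (n + 1)) t) < O.valuation t := by
      intro n
      induction n with
      | zero => simpa using hlt
      | succ n ih =>
        rw [pow_succ', AlgEquiv.mul_apply]
        exact ((hσ σ).lt_iff_lt.2 ih).trans hlt
    obtain ⟨n, hn, h1⟩ := isOfFinOrder_iff_pow_eq_one.1 (isOfFinOrder_of_finite σ)
    have := hiter (n - 1)
    rw [Nat.sub_add_cancel hn, h1] at this
    exact lt_irrefl _ this
  refine le_antisymm ?_ (hle σ t)
  simpa using hle σ⁻¹ (σ t)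

end Henselian

/-! ### Polynomials of minimal degree over a Henselian valuation ring -/

section HenselianCase

open Filter

/-- Let `f` be irreducible over the fraction field of a Henselian valuation ring. If `f y` is smaller
than `f (a i)`, then every root of `f` is closer to `y` than to `a i`, hence is as far from `a i` as
`y` is, and this distance is eventually constant. An inseparable `f` is a separable polynomial in
`X ^ p ^ n`, and the argument is applied to the `p ^ n`-th powers. -/
theorem ValuationRing.not_eventually_map_eval_lt_of_henselian (V : Type*) {K ι : Type*} [CommRing V]
    [IsDomain V] [ValuationRing V] [HenselianLocalRing V] [Field K] [Algebra V K]
    [IsFractionRing V K] [LinearOrder ι] [Nonempty ι] {a : ι → K} {y : K}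
    (hy : EventuallyConst (fun i => ValuationRing.valuation V K (y - a i)) atTop) {f : K[X]}
    (hf : Irreducible f)
    (hnc : ¬ EventuallyConst (fun i => ValuationRing.valuation V K (f.eval (a i))) atTop) :
    ¬ ∀ᶠ i in atTop,
      ValuationRing.valuation V K (f.eval y) < ValuationRing.valuation V K (f.eval (a i)) := by
  intro hlt
  obtain ⟨p, hp⟩ := ExpChar.exists K
  obtain ⟨g, hgsep, n, hgf⟩ := hf.hasSeparableContraction p
  have hgirr : Irreducible g := of_irreducible_expand_pow (expChar_ne_zero K p) (hgf ▸ hf)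
  have : ExpChar g.SplittingField p := expChar_of_injective_algebraMap
    (algebraMap K g.SplittingField).injective p
  have : IsGalois K g.SplittingField := IsGalois.of_separable_splitting_field hgsep
  obtain ⟨O, hOK, hOσ⟩ :=
    ValuationRing.exists_valuationSubring_galois_invariant V (K := K) (L := g.SplittingField)
  set φ := algebraMap K g.SplittingField with hφ
  have hsplit := SplittingField.splits g
  obtain ⟨α, hα⟩ : ∃ α, α ∈ (g.map φ).roots := by
    refine Multiset.exists_mem_of_ne_zero fun h => hgirr.natDegree_pos.ne' ?_
    rw [← natDegree_map φ, hsplit.natDegree_eq_card_roots, h, Multiset.card_zero]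
  set d := Multiset.card (g.map φ).roots with hd
  have hroot : ∀ r ∈ (g.map φ).roots, ∃ σ : g.SplittingField ≃ₐ[K] g.SplittingField, σ α = r := by
    intro r hr
    have h1 : ∀ s ∈ (g.map φ).roots, aeval s g = 0 := fun s hs => by
      rw [← eval_map_algebraMap]; exact (mem_roots'.1 hs).2
    refine minpoly.exists_algEquiv_of_root' (Algebra.IsAlgebraic.isAlgebraic α) ?_
    rw [← minpoly.eq_of_irreducible hgirr (h1 α hα), map_mul, h1 r hr, zero_mul]
  -- all roots of `g` are equally far from the elements of `K`
  have hval : ∀ b : K, O.valuation (φ (f.eval b)) =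
      O.valuation (g.map φ).leadingCoeff * O.valuation (φ b ^ p ^ n - α) ^ d := by
    intro b
    have h1 : ∀ z ∈ (g.map φ).roots.map fun r => O.valuation (φ (b ^ p ^ n) - r),
        z = O.valuation (φ (b ^ p ^ n) - α) := by
      intro z hz
      obtain ⟨r, hr, rfl⟩ := Multiset.mem_map.1 hz
      obtain ⟨σ, rfl⟩ := hroot r hr
      rw [← hOσ σ (φ (b ^ p ^ n) - α), map_sub σ, AlgEquiv.commutes]
    rw [← hgf, expand_eval, ← eval_map_apply, hsplit.eq_prod_roots, eval_mul, eval_C, map_mul,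
      eval_multiset_prod, Multiset.map_map, map_multiset_prod, Multiset.map_map]
    have h2 := Multiset.eq_replicate_card.2 h1
    rw [Multiset.card_map] at h2
    simp only [Function.comp_def, eval_sub, eval_X, eval_C]
    rw [h2, Multiset.prod_replicate, ← hsplit.eq_prod_roots, map_pow φ]
  have hOlt : ∀ a b : K, O.valuation (φ a) < O.valuation (φ b) ↔
      ValuationRing.valuation V K a < ValuationRing.valuation V K b := fun a b => by
    rw [← not_le, ← not_le, hOK]
  have hOeq : ∀ a b : K, O.valuation (φ a) = O.valuation (φ b) ↔
      ValuationRing.valuation V K a = ValuationRing.valuation V K b := fun a b => by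
    rw [le_antisymm_iff, le_antisymm_iff, hOK, hOK]
  have hfa : ∀ᶠ i in atTop, O.valuation (φ (f.eval (a i))) =
      O.valuation (g.map φ).leadingCoeff * (O.valuation (φ (y - a i)) ^ p ^ n) ^ d := by
    filter_upwards [hlt] with i hi
    rw [← hOlt, hval, hval] at hi
    have h1 := lt_of_pow_lt_pow_left₀ d zero_le (lt_of_mul_lt_mul_left' hi)
    have h2 : O.valuation (φ (y - a i)) ^ p ^ n = O.valuation (φ (a i) ^ p ^ n - α) := by
      rw [← map_pow O.valuation, map_sub φ, sub_pow_expChar_pow,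
        ← sub_sub_sub_cancel_right _ _ α, Valuation.map_sub_eq_of_lt_right _ h1]
    rw [hval, h2]
  refine hnc ?_
  obtain ⟨i₀, hi₀⟩ := eventuallyConst_atTop.1 hy
  obtain ⟨i₁, hi₁⟩ := eventually_atTop.1 hfa
  refine eventuallyConst_atTop.2 ⟨max i₀ i₁, fun j hj => ?_⟩
  rw [← hOeq, hi₁ _ ((le_max_right _ _).trans hj), hi₁ _ (le_max_right _ _),
    (hOeq (y - a j) (y - a (max i₀ i₁))).2 ((hi₀ _ ((le_max_left _ _).trans hj)).trans
      (hi₀ _ (le_max_left _ _)).symm)]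

end HenselianCase

/-! ### Polynomials of minimal degree over a valuation ring of dimension one -/

section RankOne

open Filter

/-- Lifting of a factorization into coprime factors, the first of them monic, from modulo `π` to
modulo powers of `π`. There is no bound on the degree of the second factor. -/
theorem Polynomial.exists_factorization_mod_pow {R : Type*} [CommRing R] {f P Q a b : R[X]}
    (hP : P.Monic) {π : R} (hf : C π ∣ f - P * Q) (hab : C π ∣ a * P + b * Q - 1) (k : ℕ) :
    ∃ P' Q' : R[X], P'.natDegree ≤ P.natDegree ∧ C π ∣ P' - P ∧ C π ∣ Q' - Q ∧
      C π ^ (k + 1) ∣ f - P' * Q' := by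
  induction k with
  | zero => exact ⟨P, Q, le_rfl, by simp, by simp, by simpa using hf⟩
  | succ k ih =>
    obtain ⟨P', Q', hdeg, ⟨p', hp'⟩, ⟨q', hq'⟩, ⟨h, hh⟩⟩ := ih
    obtain ⟨e, he⟩ := hab
    -- solve `p * Q + q * P ≡ h` modulo `π` with `p` of degree less than `P`
    set p := (b * h) %ₘ P with hp
    set t := (b * h) /ₘ P with ht
    have hdiv : p + P * t = b * h := modByMonic_add_div _ P
    set q := a * h + t * Q with hq
    refine ⟨P' + C π ^ (k + 1) * p, Q' + C π ^ (k + 1) * q, ?_, ?_, ?_, ?_⟩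
    · refine natDegree_add_le_of_degree_le hdeg ?_
      rw [← C_pow]
      exact (natDegree_C_mul_le _ _).trans (natDegree_modByMonic_le _ hP)
    · exact ⟨p' + C π ^ k * p, by linear_combination hp'⟩
    · exact ⟨q' + C π ^ k * q, by linear_combination hq'⟩
    · refine ⟨-(h * e) - p * q' - q * p' - C π ^ k * p * q, ?_⟩
      have h1 : h - p * Q - q * P = -(C π * (h * e)) := by
        linear_combination (-h) * he - Q * hdiv
      linear_combination hh + C π ^ (k + 1) * (h1 - p * hq' - q * hp')

variable {V K : Type*} [CommRing V] [IsDomain V] [ValuationRing V] [Field K] [Algebra V K]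
  [IsFractionRing V K]

theorem ValuationRing.valuation_algebraMap_le_iff {a b : V} :
    valuation V K (algebraMap V K a) ≤ valuation V K (algebraMap V K b) ↔ b ∣ a := by
  constructor
  · intro h
    by_cases hb : b = 0
    · subst hb
      rw [map_zero, map_zero, le_zero_iff, map_eq_zero,
        map_eq_zero_iff _ (IsFractionRing.injective V K)] at h
      simp [h]
    have hb' : algebraMap V K b ≠ 0 := by simpa using hb
    have : algebraMap V K a / algebraMap V K b ∈ (valuation V K).integer := by
      rw [Valuation.mem_integer_iff, map_div₀]
      exact div_le_one_of_le₀ h zero_le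
    obtain ⟨c, hc⟩ := (mem_integer_iff V K _).1 this
    refine ⟨c, IsFractionRing.injective V K ?_⟩
    rw [map_mul, hc, mul_div_cancel₀ _ hb']
  · rintro ⟨c, rfl⟩
    rw [map_mul, map_mul]
    exact mul_le_of_le_one_right' ((mem_integer_iff V K _).2 ⟨c, rfl⟩)

theorem ValuationRing.valuation_algebraMap_le_one (a : V) :
    valuation V K (algebraMap V K a) ≤ 1 := (mem_integer_iff V K _).2 ⟨a, rfl⟩

theorem ValuationRing.valuation_algebraMap_lt_one_iff {a : V} :
    valuation V K (algebraMap V K a) < 1 ↔ a ∈ IsLocalRing.maximalIdeal V := by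
  rw [IsLocalRing.mem_maximalIdeal, mem_nonunits_iff, ← not_le, ← map_one (valuation V K),
    ← map_one (algebraMap V K), valuation_algebraMap_le_iff, isUnit_iff_dvd_one]

theorem ValuationRing.valuation_algebraMap_eq_one_iff {a : V} :
    valuation V K (algebraMap V K a) = 1 ↔ IsUnit a := by
  rw [← IsLocalRing.notMem_maximalIdeal, ← valuation_algebraMap_lt_one_iff (K := K), not_lt]
  exact ⟨fun h => h.ge, fun h => le_antisymm (valuation_algebraMap_le_one a) h⟩

/-- In dimension one the only prime ideal that can contain `ε ≠ 0` is the maximal ideal, so `π` lies in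
the radical of `(ε)`. -/
theorem ValuationRing.exists_dvd_pow_of_ringKrullDim_eq_one (hdim : ringKrullDim V = 1)
    {π ε : V} (hπ : π ∈ IsLocalRing.maximalIdeal V) (hε : ε ≠ 0) : ∃ k, ε ∣ π ^ k := by
  have : Ring.KrullDimLE 1 V := Ring.krullDimLE_iff.2 hdim.le
  have hrad : π ∈ (Ideal.span {ε}).radical := by
    rw [Ideal.radical_eq_sInf, Submodule.mem_sInf]
    rintro J ⟨hJ, hJp⟩
    have hJ0 : J ≠ ⊥ := fun h => hε (by
      simpa [h] using hJ (Ideal.mem_span_singleton_self ε))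
    rw [IsLocalRing.eq_maximalIdeal (hJp.isMaximal_of_ne_bot hJ0)]
    exact hπ
  obtain ⟨k, hk⟩ := hrad
  exact ⟨k, Ideal.mem_span_singleton.1 hk⟩

theorem ValuationRing.exists_C_dvd_of_map_residue_eq_zero {f g : V[X]}
    (hf : f.map (IsLocalRing.residue V) = 0) (hg : g.map (IsLocalRing.residue V) = 0) :
    ∃ π ∈ IsLocalRing.maximalIdeal V, C π ∣ f ∧ C π ∣ g := by
  have key : ∀ f : V[X], f.map (IsLocalRing.residue V) = 0 →
      ∃ π ∈ IsLocalRing.maximalIdeal V, C π ∣ f := by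
    intro f hf
    by_cases h0 : f = 0
    · exact ⟨0, zero_mem _, by simp [h0]⟩
    · obtain ⟨-, ⟨j, rfl⟩, -, g, hg, -⟩ := ValuationRing.exists_eq_C_mul h0
      refine ⟨f.coeff j, ?_, g, hg⟩
      rw [← IsLocalRing.residue_eq_zero_iff, ← coeff_map, hf, coeff_zero]
  obtain ⟨π₁, h1, hd1⟩ := key f hf
  obtain ⟨π₂, h2, hd2⟩ := key g hg
  rcases ValuationRing.dvd_total π₁ π₂ with h | h
  · exact ⟨π₁, h1, hd1, (map_dvd C h).trans hd2⟩
  · exact ⟨π₂, h2, (map_dvd C h).trans hd1, hd2⟩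

/-- Let `f` be of minimal degree among the polynomials whose values along `v` are not eventually
constant, and let `y` be farther from the late `v i` than these are from each other. Then `f y`
cannot be smaller than `f (v i)` for all large `i`, where `ε` serves as a uniform bound: a
factorization modulo `ε` would yield a polynomial of smaller degree with nonconstant values. -/
theorem ValuationRing.not_eventually_map_eval_lt_of_ringKrullDim_eq_one {ι : Type*} [LinearOrder ι]
    [Nonempty ι] [NoMaxOrder ι] (hdim : ringKrullDim V = 1) {v : ι → V} {y : V} {i₀ : ι}
    (hy : ∀ i > i₀, valuation V K (algebraMap V K (v i - v i₀)) <
      valuation V K (algebraMap V K (v i₀ - y))) {f : V[X]}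
    (hmin : ∀ p : K[X], p.natDegree < f.natDegree →
      EventuallyConst (fun i => valuation V K (p.eval (algebraMap V K (v i)))) atTop)
    (hnc : ¬ EventuallyConst (fun i => valuation V K (algebraMap V K (f.eval (v i)))) atTop)
    {ε : V} (hε : ε ≠ 0)
    (hle : valuation V K (algebraMap V K (f.eval y)) ≤ valuation V K (algebraMap V K ε)) :
    ¬ ∀ᶠ i in atTop, valuation V K (algebraMap V K ε) <
      valuation V K (algebraMap V K (f.eval (v i))) := by
  intro hlt
  set val : V → ValueGroup V K := fun a => valuation V K (algebraMap V K a) with hval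
  have hvalmul : ∀ a b, val (a * b) = val a * val b := fun a b => by simp [hval]
  have hgt := eventually_gt_atTop i₀
  set b := v i₀ - y with hb
  have hb0 : b ≠ 0 := by
    obtain ⟨i, hi⟩ := exists_gt i₀
    have := zero_le.trans_lt (hy i hi)
    rintro h
    rw [h, map_zero, map_zero] at this
    exact lt_irrefl _ this
  have hμ : ∀ i, ∃ μ, i₀ < i → μ ∈ IsLocalRing.maximalIdeal V ∧ v i - v i₀ = b * μ := by
    intro i
    by_cases hi : i₀ < i
    · obtain ⟨μ, hμ⟩ := valuation_algebraMap_le_iff.1 (hy i hi).le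
      refine ⟨μ, fun _ => ⟨?_, hμ⟩⟩
      have h1 := hy i hi
      rw [hμ, map_mul, map_mul] at h1
      rw [← valuation_algebraMap_lt_one_iff (K := K)]
      exact lt_of_mul_lt_mul_left' (h1.trans_eq (mul_one _).symm)
    · exact ⟨0, fun h => absurd h hi⟩
  choose μ hμ using hμ
  have hf0 : f.natDegree ≠ 0 := fun h => hnc <| by
    rw [eq_C_of_natDegree_eq_zero h]
    simp [EventuallyConst.const]
  -- the substitution `X ↦ b X + y` makes the sequence `v` residually constant, equal to `1`
  set F := f.comp (C b * X + C y) with hF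
  have hFdeg : F.natDegree = f.natDegree := by
    rw [hF, natDegree_comp, natDegree_linear hb0, mul_one]
  have hF0 : F ≠ 0 := fun h => hf0 (by rw [← hFdeg, h, natDegree_zero])
  obtain ⟨s, -, hs0, G, hFG, j, hj⟩ := exists_eq_C_mul hF0
  have hFv : ∀ i > i₀, f.eval (v i) = s * G.eval (1 + μ i) := fun i hi => by
    have h1 : F.eval (1 + μ i) = f.eval (v i) := by
      rw [hF, eval_comp]
      congr 1
      simp only [eval_add, eval_mul, eval_C, eval_X]
      linear_combination hb - (hμ i hi).2
    rw [← h1, hFG, eval_mul, eval_C]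
  have hFy : f.eval y = s * G.eval 0 := by
    have h1 : F.eval 0 = f.eval y := by
      rw [hF, eval_comp]
      simp
    rw [← h1, hFG, eval_mul, eval_C]
  set ρ := IsLocalRing.residue V with hρ
  have hρev : ∀ (p : V[X]) (c : V), ρ (p.eval c) = (p.map ρ).eval (ρ c) := fun p c =>
    (eval_map_apply ρ c).symm
  have hρμ : ∀ i > i₀, ρ (1 + μ i) = 1 := fun i hi => by
    rw [map_add, map_one, (IsLocalRing.residue_eq_zero_iff _).2 (hμ i hi).1, add_zero]
  have hunit : ∀ c : V, ρ c ≠ 0 → val c = 1 := fun c hc => by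
    rwa [hval, valuation_algebraMap_eq_one_iff, ← IsLocalRing.residue_ne_zero_iff_isUnit]
  have hG1 : (G.map ρ).eval 1 = 0 := by
    by_contra hne
    refine hnc (eventuallyConst_iff_exists_eventuallyEq.2 ⟨val s, ?_⟩)
    filter_upwards [hgt] with i hi
    show val _ = _
    rw [hFv i hi, hvalmul, hunit (G.eval _) (by rwa [hρev, hρμ i hi]), mul_one]
  have hG0 : (G.map ρ).eval 0 = 0 := by
    by_contra hne
    obtain ⟨i, hi, hi'⟩ := (hlt.and hgt).exists
    have h1 : val (f.eval y) = val s := by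
      rw [hFy, hvalmul, hunit (G.eval _) (by rwa [hρev, map_zero]), mul_one]
    have h2 : val (f.eval (v i)) ≤ val s := by
      rw [hFv i hi', hvalmul]
      exact mul_le_of_le_one_right' (valuation_algebraMap_le_one _)
    exact (hi.trans_le h2).not_ge (h1 ▸ hle)
  have hGmap : G.map ρ ≠ 0 := fun h => by
    have := congrArg (coeff · j) h
    simp [hj] at this
  obtain ⟨q₀, hq₀, hq₀dvd⟩ := exists_eq_pow_rootMultiplicity_mul_and_not_dvd _ hGmap 1
  set m := (G.map ρ).rootMultiplicity 1 with hm
  have hq₀1 : q₀.eval 1 ≠ 0 := fun h => hq₀dvd (dvd_iff_isRoot.2 h)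
  -- `q₀` vanishes at `0`, so it is not constant
  have hmn : m < f.natDegree := by
    have h1 : q₀.natDegree ≠ 0 := by
      intro h
      rw [hq₀, eq_C_of_natDegree_eq_zero h] at hG0
      rw [eq_C_of_natDegree_eq_zero h] at hq₀1
      simp at hG0 hq₀1
      exact hq₀1 hG0
    have h2 : (G.map ρ).natDegree = m + q₀.natDegree := by
      conv_lhs => rw [hq₀]
      rw [Monic.natDegree_mul' ((monic_X_sub_C _).pow _) (by rintro rfl; simp at h1),
        natDegree_pow, natDegree_X_sub_C, mul_one]
    have h3 : (G.map ρ).natDegree ≤ G.natDegree := natDegree_map_le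
    have h4 : F.natDegree = G.natDegree := by rw [hFG, natDegree_C_mul hs0]
    omega
  set P : V[X] := (X - C 1) ^ m with hP
  have hPmonic : P.Monic := (monic_X_sub_C 1).pow m
  have hPdeg : P.natDegree = m := by
    rw [hP, natDegree_pow, natDegree_X_sub_C, mul_one]
  have hPmap : P.map ρ = (X - C 1) ^ m := by
    simp [hP, Polynomial.map_pow, Polynomial.map_sub]
  have hsurj : Function.Surjective (Polynomial.map ρ) :=
    Polynomial.map_surjective _ IsLocalRing.residue_surjective
  obtain ⟨Q, hQ⟩ := hsurj q₀
  have hcop : IsCoprime ((X - C 1) ^ m) q₀ :=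
    ((irreducible_X_sub_C _).coprime_iff_not_dvd.2 hq₀dvd).pow_left
  obtain ⟨a', b', hab⟩ := hcop
  obtain ⟨A, rfl⟩ := hsurj a'
  obtain ⟨B, rfl⟩ := hsurj b'
  obtain ⟨π, hπ, hπ1, hπ2⟩ := exists_C_dvd_of_map_residue_eq_zero (f := G - P * Q)
    (g := A * P + B * Q - 1)
    (by rw [Polynomial.map_sub, Polynomial.map_mul, hPmap, hQ]; exact sub_eq_zero.2 hq₀)
    (by rw [Polynomial.map_sub, Polynomial.map_add, Polynomial.map_mul, Polynomial.map_mul, hPmap,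
          hQ, hab, Polynomial.map_one, sub_self])
  obtain ⟨k, hk⟩ := exists_dvd_pow_of_ringKrullDim_eq_one hdim hπ hε
  obtain ⟨P', Q', hP'deg, -, ⟨q', hq'⟩, ⟨r, hr⟩⟩ :=
    exists_factorization_mod_pow hPmonic hπ1 hπ2 k
  -- `Q'` takes unit values at the residually constant sequence, so `P'` carries the values of `f`
  have hfac : ∀ᶠ i in atTop, val (f.eval (v i)) = val s * val (P'.eval (1 + μ i)) := by
    filter_upwards [hgt, hlt] with i hi hilt
    have h1 : val (Q'.eval (1 + μ i)) = 1 := by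
      refine hunit _ ?_
      have h2 := congrArg (fun p => ρ (p.eval (1 + μ i))) hq'
      simp only [eval_sub, eval_mul, eval_C, map_sub, map_mul,
        (IsLocalRing.residue_eq_zero_iff _).2 hπ, hρ, zero_mul, sub_eq_zero] at h2
      rw [hρ, h2, ← hρ, hρev, hρμ i hi, hQ]
      exact hq₀1
    have h3 : val (f.eval (v i) - s * (P' * Q').eval (1 + μ i)) < val (f.eval (v i)) := by
      refine lt_of_le_of_lt (valuation_algebraMap_le_iff.2 ?_) hilt
      rw [hFv i hi, ← mul_sub, ← eval_sub, hr, eval_mul, eval_pow, eval_C, pow_succ]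
      exact ((hk.mul_right _).mul_right _).mul_left _
    have h4 : val (f.eval (v i)) = val (s * (P' * Q').eval (1 + μ i)) := by
      simp only [hval, map_sub] at h3 ⊢
      simpa using (Valuation.map_sub_eq_of_lt_left _ h3).symm
    rw [h4, eval_mul, hvalmul, hvalmul, h1, mul_one]
  have hbK : algebraMap V K b ≠ 0 := by simpa using hb0
  have hconst := hmin ((P'.map (algebraMap V K)).comp
    (C (algebraMap V K b)⁻¹ * (X - C (algebraMap V K y)))) (by
      refine lt_of_le_of_lt natDegree_comp_le ?_
      have h1 : (C (algebraMap V K b)⁻¹ * (X - C (algebraMap V K y))).natDegree = 1 := by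
        rw [natDegree_C_mul (inv_ne_zero hbK), natDegree_X_sub_C]
      rw [h1, mul_one]
      exact natDegree_map_le.trans_lt (hP'deg.trans_lt (hPdeg ▸ hmn)))
  refine hnc (((EventuallyConst.const (val s)).mul hconst).congr ?_)
  filter_upwards [hgt, hfac] with i hi hi'
  refine Eq.trans ?_ hi'.symm
  rw [Pi.mul_apply, eval_comp, eval_mul, eval_C, eval_sub, eval_X, eval_C, ← map_sub]
  have h1 : v i - y = b * (1 + μ i) := by linear_combination (hμ i hi).2 - hb
  rw [h1, map_mul, inv_mul_cancel_left₀ hbK, eval_map_apply]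

end RankOne

/-! ### A criterion for transcendental sequences -/

section Transcendence

open Filter

variable {V K K' Γ ι : Type*} [CommRing V] [IsDomain V] [ValuationRing V] [Field K] [Algebra V K]
  [IsFractionRing V K] [Field K'] [Algebra K K'] [Algebra V K'] [IsScalarTower V K K']
  [LinearOrderedCommGroupWithZero Γ] [LinearOrder ι] [Nonempty ι] [NoMaxOrder ι]

theorem Polynomial.hasseDeriv_map {R S : Type*} [Semiring R] [Semiring S] (φ : R →+* S) (k : ℕ)
    (f : R[X]) : hasseDeriv k (f.map φ) = (hasseDeriv k f).map φ := by
  ext n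
  simp [hasseDeriv_coeff]

/-- If the polynomials over `V` take, on `V`, values at most that at the pseudo limit `x`, then `v` is
a transcendental sequence. The valuation `w` of the immediate extension enters only through `hw` and
`hsurj`, and `hnl` says that `v` has no pseudo limit in `V`. -/
theorem ValuationRing.eventuallyConst_of_exists_le (hV : ringKrullDim V = 1 ∨ HenselianLocalRing V)
    {w : Valuation K' Γ}
    (hw : ∀ a b : K, w (algebraMap K K' a) ≤ w (algebraMap K K' b) ↔
      valuation V K a ≤ valuation V K b)
    (hsurj : ∀ z : K', ∃ a : K, w (algebraMap K K' a) = w z)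
    {v : ι → V} {x : K'} (hxtr : Transcendental K x)
    (hanti : StrictAnti fun i => w (x - algebraMap V K' (v i)))
    (hx : ∀ i j, i < j → w (x - algebraMap V K' (v i)) = w (algebraMap V K' (v i - v j)))
    (hnl : ∀ y : V, ∃ i, w (algebraMap V K' (y - v i)) ≠ w (x - algebraMap V K' (v i)))
    (h : ∀ f : V[X], aeval x f ≠ 0 → ∃ y : V, w (algebraMap V K' (f.eval y)) ≤ w (aeval x f))
    (f : V[X]) :
    EventuallyConst (fun i => valuation V K (algebraMap V K (f.eval (v i)))) atTop := by
  have hweq : ∀ a b : K, w (algebraMap K K' a) = w (algebraMap K K' b) ↔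
      valuation V K a = valuation V K b := fun a b => by
    rw [le_antisymm_iff, le_antisymm_iff, hw, hw]
  have hwlt : ∀ a b : K, w (algebraMap K K' a) < w (algebraMap K K' b) ↔
      valuation V K a < valuation V K b := fun a b => by
    rw [← not_le, ← not_le, hw]
  have hVK : ∀ a : V, algebraMap V K' a = algebraMap K K' (algebraMap V K a) :=
    IsScalarTower.algebraMap_apply V K K'
  have hconst : ∀ z : ι → V, EventuallyConst (fun i => w (algebraMap V K' (z i))) atTop ↔
      EventuallyConst (fun i => valuation V K (algebraMap V K (z i))) atTop := fun z => by
    simp only [eventuallyConst_atTop, hVK, hweq]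
  induction hn : f.natDegree using Nat.strong_induction_on generalizing f with
  | _ n ih =>
  by_contra hnc
  have hn0 : n ≠ 0 := fun h0 => hnc <| by
    rw [eq_C_of_natDegree_eq_zero (hn.trans h0)]
    simp [EventuallyConst.const]
  -- minimality of the degree passes to polynomials over `K` by clearing denominators
  have hmin : ∀ p : K[X], p.natDegree < f.natDegree →
      EventuallyConst (fun i => valuation V K (p.eval (algebraMap V K (v i)))) atTop := by
    intro p hp
    obtain ⟨b, hbV, hb⟩ := IsLocalization.integerNormalization_spec (nonZeroDivisors V) p
    set q := IsLocalization.integerNormalization (nonZeroDivisors V) p with hq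
    have hb0 : algebraMap V K b ≠ 0 := by
      simpa using nonZeroDivisors.ne_zero hbV
    have hb' : q.map (algebraMap V K) = C (algebraMap V K b) * p := by
      rw [hb, ← smul_eq_C_mul, algebraMap_smul]
    have hdeg : q.natDegree = p.natDegree := by
      rw [← natDegree_map_eq_of_injective (IsFractionRing.injective V K) q, hb',
        natDegree_C_mul hb0]
    have := (EventuallyConst.const (valuation V K (algebraMap V K b))⁻¹).mul
      (ih _ (by omega) q rfl)
    refine this.congr (Eventually.of_forall fun i => ?_)
    rw [Pi.mul_apply, ← eval_map_apply, hb', eval_mul, eval_C, map_mul,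
      inv_mul_cancel_left₀ ((Valuation.ne_zero_iff _).2 hb0)]
  have hderiv : ∀ k ≠ 0, EventuallyConst
      (fun i => w ((hasseDeriv k (f.map (algebraMap V K'))).eval (algebraMap V K' (v i))))
      atTop := fun k hk => by
    simp only [hasseDeriv_map, eval_map_apply]
    refine (hconst _).2 (ih _ ?_ (hasseDeriv k f) rfl)
    have := natDegree_hasseDeriv_le f k
    omega
  have hlt : ∀ᶠ i in atTop, w (aeval x f) < w (algebraMap V K' (f.eval (v i))) := by
    have := Valuation.map_eval_lt_of_not_eventuallyConst hanti hderiv (by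
      simp only [eval_map_apply]
      rwa [hconst])
    simpa only [eval_map_apply, ← eval_map_algebraMap f x] using this
  have hxf : aeval x f ≠ 0 := fun h0 => by
    have htr : Transcendental V x := fun halg => hxtr (halg.extendScalars
      (IsFractionRing.injective V K))
    have := (transcendental_iff.1 htr) f h0
    simp [this] at hn
    exact hn0 hn.symm
  obtain ⟨y, hy⟩ := h f hxf
  -- an element of `V` is not a pseudo limit, hence is farther away from `v i` than `x` is
  obtain ⟨i₀, hi₀⟩ : ∃ i₀, ∀ i > i₀, w (algebraMap V K' (v i - v i₀)) <
      w (algebraMap V K' (v i₀ - y)) := by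
    have hsymm : ∀ i j, i < j → w (algebraMap V K' (v j - v i)) =
        w (x - algebraMap V K' (v i)) := fun i j hij => by
      rw [hx i j hij, ← neg_sub, map_neg, Valuation.map_neg]
    have hsymm' : ∀ i, w (algebraMap V K' (v i - y)) = w (algebraMap V K' (y - v i)) := fun i => by
      rw [← neg_sub, map_neg, Valuation.map_neg]
    obtain ⟨i, hi⟩ := hnl y
    rcases lt_or_gt_of_ne hi with hi | hi
    · obtain ⟨i', hi'⟩ := exists_gt i
      refine ⟨i', fun j hj => ?_⟩
      have h1 : w (algebraMap V K' (v i' - y)) = w (x - algebraMap V K' (v i)) := by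
        rw [← hsymm i i' hi', ← sub_sub_sub_cancel_right (v i') y (v i), map_sub,
          Valuation.map_sub_eq_of_lt_left]
        rwa [hsymm i i' hi']
      rw [h1, hsymm i' j hj]
      exact hanti hi'
    · exact ⟨i, fun j hj => by rwa [hsymm i j hj, hsymm' i]⟩
  rcases hV with hdim | hhens
  · obtain ⟨e, he⟩ := hsurj (aeval x f)
    obtain ⟨ε, rfl⟩ : ∃ ε : V, algebraMap V K ε = e := by
      obtain ⟨i, hi⟩ := hlt.exists
      rw [← he, hVK, hwlt] at hi
      exact (mem_integer_iff V K e).1 (hi.le.trans (valuation_algebraMap_le_one _))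
    have hε : ε ≠ 0 := by
      rintro rfl
      rw [map_zero, map_zero, map_zero, eq_comm, map_eq_zero] at he
      exact hxf he
    refine not_eventually_map_eval_lt_of_ringKrullDim_eq_one hdim (i₀ := i₀) (y := y)
      (fun i hi => ?_) hmin hnc hε ?_ ?_
    · rw [← hwlt, ← hVK, ← hVK]; exact hi₀ i hi
    · rw [← hw, he, ← hVK]; exact hy
    · filter_upwards [hlt] with i hi
      rwa [← hwlt, he, ← hVK]
  · have hfK : ∀ i, (f.map (algebraMap V K)).eval (algebraMap V K (v i)) =
        algebraMap V K (f.eval (v i)) := fun i => eval_map_apply _ _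
    have hdegK : (f.map (algebraMap V K)).natDegree = f.natDegree :=
      natDegree_map_eq_of_injective (IsFractionRing.injective V K) f
    have hf0 : f.map (algebraMap V K) ≠ 0 := fun h0 => hn0 (by
      rw [← hn, ← hdegK, h0, natDegree_zero])
    have hirr : Irreducible (f.map (algebraMap V K)) := by
      refine ⟨fun hu => hn0 (by rw [← hn, ← hdegK, natDegree_eq_zero_of_isUnit hu]), ?_⟩
      intro p q hpq
      by_contra! hu
      have hp0 : p ≠ 0 := by rintro rfl; simp [hpq] at hf0
      have hq0 : q ≠ 0 := by rintro rfl; simp [hpq] at hf0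
      have hadd : p.natDegree + q.natDegree = f.natDegree := by
        rw [← hdegK, hpq, natDegree_mul hp0 hq0]
      have hp : p.natDegree ≠ 0 := fun h0 => hu.1 (isUnit_iff_degree_eq_zero.2 (by
        rw [degree_eq_natDegree hp0, h0]; rfl))
      have hq : q.natDegree ≠ 0 := fun h0 => hu.2 (isUnit_iff_degree_eq_zero.2 (by
        rw [degree_eq_natDegree hq0, h0]; rfl))
      refine hnc (((hmin p (by omega)).mul (hmin q (by omega))).congr
        (Eventually.of_forall fun i => ?_))
      rw [Pi.mul_apply, ← map_mul, ← eval_mul, ← hpq, hfK]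
    refine not_eventually_map_eval_lt_of_henselian V (y := algebraMap V K y)
      (a := fun i => algebraMap V K (v i)) ?_ hirr (by simpa only [hfK] using hnc) ?_
    · refine eventuallyConst_iff_exists_eventuallyEq.2
        ⟨valuation V K (algebraMap V K (v i₀ - y)), ?_⟩
      filter_upwards [eventually_gt_atTop i₀] with i hi
      have h1 := hi₀ i hi
      show valuation V K (algebraMap V K y - algebraMap V K (v i)) = _
      rw [← map_sub, ← hweq, ← hVK, ← hVK, ← neg_sub, map_neg, Valuation.map_neg,
        ← sub_add_sub_cancel (v i) (v i₀) y, map_add, Valuation.map_add_eq_of_lt_right _ h1]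
    · filter_upwards [hlt] with i hi
      rw [eval_map_apply, eval_map_apply, ← hwlt, ← hVK, ← hVK]
      exact hy.trans_lt hi

end Transcendence

/-! ### Localizations of polynomial subalgebras -/

section LocalizedPolynomial

variable {V B : Type*} [CommRing V] [CommRing B] [Algebra V B]

/-- The subalgebra of `B` of all fractions `p / s` with `p`, `s` in the subalgebra `A` and `s`
invertible in `B`. -/
def Subalgebra.fractionsInside (A : Subalgebra V B) : Subalgebra V B where
  carrier := {b | ∃ p ∈ A, ∃ s ∈ A, IsUnit s ∧ b * s = p}
  mul_mem' := by
    rintro a b ⟨p, hp, s, hs, hu, h⟩ ⟨p', hp', s', hs', hu', h'⟩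
    exact ⟨p * p', A.mul_mem hp hp', s * s', A.mul_mem hs hs', hu.mul hu',
      by rw [← h, ← h']; ring⟩
  add_mem' := by
    rintro a b ⟨p, hp, s, hs, hu, h⟩ ⟨p', hp', s', hs', hu', h'⟩
    exact ⟨p * s' + p' * s, A.add_mem (A.mul_mem hp hs') (A.mul_mem hp' hs), s * s',
      A.mul_mem hs hs', hu.mul hu', by rw [← h, ← h']; ring⟩
  algebraMap_mem' r := ⟨_, A.algebraMap_mem r, 1, A.one_mem, isUnit_one, mul_one _⟩

theorem Subalgebra.le_fractionsInside (A : Subalgebra V B) : A ≤ A.fractionsInside :=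
  fun a ha => ⟨a, ha, 1, A.one_mem, isUnit_one, mul_one a⟩

theorem Subalgebra.fractionsInside_mono {A A' : Subalgebra V B} (h : A ≤ A') :
    A.fractionsInside ≤ A'.fractionsInside := by
  rintro b ⟨p, hp, s, hs, hu, hb⟩
  exact ⟨p, h hp, s, h hs, hu, hb⟩

theorem Subalgebra.isLocalizationOfSubalgebra_fractionsInside (A : Subalgebra V B) :
    IsLocalizationOfSubalgebra A A.fractionsInside := by
  refine ⟨A.le_fractionsInside, (IsUnit.submonoid B).comap A.val, ?_⟩
  let : Algebra A A.fractionsInside :=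
    (Subalgebra.inclusion A.le_fractionsInside).toRingHom.toAlgebra
  refine ⟨⟨fun s => ?_, fun b => ?_, fun {a b} h => ⟨1, ?_⟩⟩⟩
  · obtain ⟨t, ht⟩ := (show IsUnit ((s : A) : B) from s.2).exists_right_inv
    refine IsUnit.of_mul_eq_one
      ⟨t, 1, A.one_mem, (s : A), (s : A).2, s.2, by rw [mul_comm]; exact ht⟩ (Subtype.ext ht)
  · obtain ⟨b, p, hp, s, hs, hu, hb⟩ := b
    exact ⟨(⟨p, hp⟩, ⟨⟨s, hs⟩, hu⟩), Subtype.ext hb⟩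
  · have h' : (a : B) = b := (Subtype.ext_iff.1 h :)
    rw [Subtype.ext h']

/-- Evaluation of the variable `u` at an element of `V` with the same residue preserves residues of
polynomials in `u`. Hence it maps the denominators, which are units of `B`, to units of `V`. -/
theorem IsLocalizationOfSubalgebra.nonempty_algHom [IsLocalRing V] [IsLocalRing B]
    [IsLocalHom (algebraMap V B)]
    (hres : Function.Surjective (IsLocalRing.ResidueField.map (algebraMap V B)))
    {A C : Subalgebra V B} (hA : IsPolynomialSubalgebra A) (hAC : IsLocalizationOfSubalgebra A C) :
    Nonempty (C →ₐ[V] V) := by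
  obtain ⟨u, hu, rfl⟩ := hA
  obtain ⟨hle, S, hS⟩ := hAC
  obtain ⟨η, hη⟩ := hres (IsLocalRing.residue B u)
  obtain ⟨y, rfl⟩ := IsLocalRing.residue_surjective η
  rw [IsLocalRing.ResidueField.map_residue, ← sub_eq_zero, ← map_sub,
    IsLocalRing.residue_eq_zero_iff] at hη
  have hinj : Function.Injective (aeval u : V[X] →ₐ[V] B) := transcendental_iff_injective.1 hu
  let e : V[X] ≃ₐ[V] Algebra.adjoin V {u} := (AlgEquiv.ofInjective (aeval u) hinj).trans
    (Subalgebra.equivOfEq _ _ (Algebra.adjoin_singleton_eq_range_aeval V u).symm)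
  have he : ∀ p, (e p : B) = aeval u p := fun p => rfl
  let ψ : Algebra.adjoin V {u} →ₐ[V] V := (aeval y).comp (e.symm : Algebra.adjoin V {u} →ₐ[V] V[X])
  have hψ : ∀ a : Algebra.adjoin V {u}, IsUnit (a : B) → IsUnit (ψ a) := by
    intro a ha
    obtain ⟨p, rfl⟩ := e.surjective a
    have h1 : ψ (e p) = p.eval y := by
      show aeval y (e.symm (e p)) = _
      rw [e.symm_apply_apply, coe_aeval_eq_eval]
    refine isUnit_of_map_unit (algebraMap V B) _ ?_
    rw [h1, ← IsLocalRing.notMem_maximalIdeal]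
    intro hmem
    rw [he, ← IsLocalRing.notMem_maximalIdeal] at ha
    refine ha ?_
    have h2 : aeval (algebraMap V B y) p - aeval u p ∈ IsLocalRing.maximalIdeal B := by
      rw [← eval_map_algebraMap, ← eval_map_algebraMap]
      exact Ideal.mem_of_dvd _ (sub_dvd_eval_sub _ _ _) hη
    rw [aeval_algebraMap_apply, coe_aeval_eq_eval] at h2
    exact (Submodule.sub_mem_iff_right _ hmem).1 h2
  let : Algebra (Algebra.adjoin V {u}) C := (Subalgebra.inclusion hle).toRingHom.toAlgebra
  have hS' : IsLocalization S C := hS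
  have hSψ : ∀ s : S, IsUnit (ψ.toRingHom s) := fun s =>
    hψ _ ((IsLocalization.map_units C s).map C.val)
  refine ⟨{ IsLocalization.lift (S := C) hSψ with commutes' := fun r => ?_ }⟩
  have h3 : algebraMap V C r = algebraMap (Algebra.adjoin V {u}) C (algebraMap V _ r) := rfl
  show IsLocalization.lift (S := C) hSψ (algebraMap V C r) = _
  rw [h3, IsLocalization.lift_eq]
  exact ψ.commutes r

/-- If `f x = d t` with a unit `t`, a member of the filtered union containing `x`, `t` and `t⁻¹` has a
retraction to `V`, which carries this equation to `V`. -/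
theorem IsFilteredUnionOfLocalizedPolynomial.exists_associated_eval [IsLocalRing V] [IsLocalRing B]
    [IsLocalHom (algebraMap V B)]
    (hres : Function.Surjective (IsLocalRing.ResidueField.map (algebraMap V B)))
    (h : IsFilteredUnionOfLocalizedPolynomial V B) {x : B} {f : V[X]} {d : V}
    (hd : Associated (algebraMap V B d) (aeval x f)) : ∃ y : V, Associated d (f.eval y) := by
  obtain ⟨𝓕, -, hdir, hloc, hcov⟩ := h
  obtain ⟨t, ht⟩ := hd
  obtain ⟨C₁, h1, hx⟩ := hcov x
  obtain ⟨C₂, h2, ht₂⟩ := hcov t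
  obtain ⟨C₃, h3, ht₃⟩ := hcov (t⁻¹ : Bˣ)
  obtain ⟨D, hD, h1D, h2D⟩ := hdir C₁ h1 C₂ h2
  obtain ⟨E, hE, hDE, h3E⟩ := hdir D hD C₃ h3
  obtain ⟨A, hA, hAE⟩ := hloc E hE
  obtain ⟨φ⟩ := hAE.nonempty_algHom hres hA
  let x' : E := ⟨x, hDE (h1D hx)⟩
  let t' : E := ⟨t, hDE (h2D ht₂)⟩
  have ht' : IsUnit t' := IsUnit.of_mul_eq_one ⟨_, h3E ht₃⟩ (Subtype.ext t.mul_inv)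
  have heq : algebraMap V E d * t' = aeval x' f := by
    refine Subtype.ext (ht.trans ?_)
    exact (aeval_algHom_apply E.val x' f).symm ▸ rfl
  refine ⟨φ x', (ht'.map φ).unit, ?_⟩
  have := congrArg φ heq
  rw [map_mul, φ.commutes, ← aeval_algHom_apply, coe_aeval_eq_eval] at this
  exact this

end LocalizedPolynomial

/-! ### Transcendental pseudo limits -/

section PseudoLimit

open Filter

variable {V V' K K' ι : Type*} [CommRing V] [IsDomain V] [ValuationRing V]
  [CommRing V'] [IsDomain V'] [ValuationRing V'] [Field K] [Algebra V K] [IsFractionRing V K]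
  [Field K'] [Algebra V' K'] [IsFractionRing V' K'] [Algebra V V'] [Algebra K K'] [Algebra V K']
  [IsScalarTower V K K'] [IsScalarTower V V' K'] [LinearOrder ι] [Nonempty ι] [NoMaxOrder ι]

open ValuationRing in
/-- The pseudo limit of a transcendental sequence generates a filtered union of localized polynomial
algebras, in the variables `u i = (x - v i) / d i`, where `d i ∈ V` has the value of `x - v i`. -/
theorem isFilteredUnionOfLocalizedPolynomial_of_eventuallyConst
    [IsLocalHom (algebraMap V V')]
    (hw : ∀ a b : V, valuation V' K' (algebraMap V K' a) ≤ valuation V' K' (algebraMap V K' b) ↔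
      b ∣ a)
    {v : ι → V} {x : V'} (hxtr : Transcendental K (algebraMap V' K' x))
    (hgen : IntermediateField.adjoin K {algebraMap V' K' x} = ⊤)
    (hanti : StrictAnti fun i => valuation V' K' (algebraMap V' K' x - algebraMap V K' (v i)))
    (hx : ∀ i j, i < j → valuation V' K' (algebraMap V' K' x - algebraMap V K' (v i)) =
      valuation V' K' (algebraMap V K' (v i - v j)))
    (hconst : ∀ f : V[X],
      EventuallyConst (fun i => valuation V' K' (algebraMap V K' (f.eval (v i)))) atTop) :
    IsFilteredUnionOfLocalizedPolynomial V V' := by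
  set w := valuation V' K' with hwdef
  have hVV' : ∀ a : V, algebraMap V K' a = algebraMap V' K' (algebraMap V V' a) :=
    IsScalarTower.algebraMap_apply V V' K'
  have hinj : Function.Injective (algebraMap V V') := by
    have h1 : Function.Injective (algebraMap V K') := by
      rw [IsScalarTower.algebraMap_eq V K K']
      exact (algebraMap K K').injective.comp (IsFractionRing.injective V K)
    rw [IsScalarTower.algebraMap_eq V V' K'] at h1
    exact Function.Injective.of_comp h1
  choose next hnext using fun i : ι => exists_gt i
  set d : ι → V := fun i => v i - v (next i) with hd
  have hwd : ∀ i, w (algebraMap V' K' x - algebraMap V K' (v i)) = w (algebraMap V K' (d i)) :=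
    fun i => hx i _ (hnext i)
  have hd0 : ∀ i, d i ≠ 0 := fun i h0 => by
    have h1 := zero_le.trans_lt (hanti (hnext i))
    simp only [hwd, h0, map_zero, lt_self_iff_false] at h1
  have hu : ∀ i, ∃ u, x - algebraMap V V' (v i) = algebraMap V V' (d i) * u := fun i => by
    refine (valuation_algebraMap_le_iff (K := K')).1 ?_
    rw [map_sub, ← hVV', ← hVV', ← hwdef, hwd]
  choose u hu using hu
  have hdtr : ∀ i, Transcendental V (u i) := fun i halg => by
    have h1 : IsAlgebraic V x := by
      have h2 : x = algebraMap V V' (d i) * u i + algebraMap V V' (v i) := by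
        rw [← hu, sub_add_cancel]
      rw [h2]
      exact ((isAlgebraic_algebraMap _).mul halg).add (isAlgebraic_algebraMap _)
    exact hxtr ((h1.algebraMap (A := K')).extendScalars (IsFractionRing.injective V K))
  set A : ι → Subalgebra V V' := fun i => Algebra.adjoin V {u i} with hA
  have huA : ∀ i, u i ∈ A i := fun i => Algebra.self_mem_adjoin_singleton V (u i)
  have hmono : Monotone A := by
    intro i j hij
    rcases hij.eq_or_lt with rfl | hij
    · exact le_rfl
    refine Algebra.adjoin_le (Set.singleton_subset_iff.2 ?_)
    obtain ⟨c, hc⟩ : d i ∣ v i - v j := (hw _ _).1 (by rw [← hx i j hij, ← hwd])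
    obtain ⟨c', hc'⟩ : d i ∣ d j := (hw _ _).1 (by rw [← hwd, ← hwd]; exact (hanti hij).le)
    have h1 : u i = algebraMap V V' c' * u j - algebraMap V V' c := by
      refine mul_left_cancel₀ ((map_ne_zero_iff _ hinj).2 (hd0 i)) ?_
      have h2 := congrArg (algebraMap V V') hc
      have h3 := congrArg (algebraMap V V') hc'
      rw [map_sub, map_mul] at h2
      rw [map_mul] at h3
      linear_combination hu j - hu i - h2 + u j * h3
    rw [h1]
    exact (A j).sub_mem ((A j).mul_mem ((A j).algebraMap_mem _) (huA j)) ((A j).algebraMap_mem _)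
  -- each `f x` is eventually a constant times an element of `V[u i]` invertible in `V'`
  have key : ∀ f : V[X], f ≠ 0 → ∀ᶠ i in atTop, ∃ c : V, c ≠ 0 ∧ ∃ t ∈ A i, IsUnit t ∧
      aeval x f = algebraMap V V' c * t := by
    intro f hf
    have hVK' : Function.Injective (algebraMap V K') := by
      rw [IsScalarTower.algebraMap_eq V V' K']
      exact (IsFractionRing.injective V' K').comp hinj
    have h0 := Valuation.map_hasseDeriv_mul_lt_of_eventuallyConst hanti
      (f := f.map (algebraMap V K')) ((Polynomial.map_ne_zero_iff hVK').2 hf) (fun k => by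
        simp only [hasseDeriv_map, eval_map_apply]
        exact hconst _)
    filter_upwards [h0] with i hi
    simp only [hasseDeriv_map, eval_map_apply, map_mul, map_pow, hwd] at hi
    have hfi : f.eval (v i) ≠ 0 := fun h => hi.1 (by rw [h, map_zero])
    have he : ∀ l, ∃ e, l ≠ 0 → e ∈ IsLocalRing.maximalIdeal V ∧
        (hasseDeriv l f).eval (v i) * d i ^ l = f.eval (v i) * e := by
      intro l
      by_cases hl : l = 0
      · exact ⟨0, fun h => absurd hl h⟩
      have h1 := hi.2 l hl
      simp only [← map_pow, ← map_mul] at h1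
      obtain ⟨e, he⟩ := (hw _ _).1 h1.le
      refine ⟨e, fun _ => ⟨fun hue => ?_, he⟩⟩
      exact h1.not_ge ((hw _ _).2 (by rw [he]; exact hue.mul_right_dvd.2 dvd_rfl))
    choose e he using he
    set r : V' := ∑ l ∈ Finset.Icc 1 f.natDegree, algebraMap V V' (e l) * u i ^ l with hr
    have hrm : r ∈ IsLocalRing.maximalIdeal V' := by
      refine Ideal.sum_mem _ fun l hl => Ideal.mul_mem_right _ _ ?_
      have hl0 : l ≠ 0 := by have := (Finset.mem_Icc.1 hl).1; omega
      exact fun hue => (he l hl0).1 (isUnit_of_map_unit (algebraMap V V') _ hue)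
    refine ⟨f.eval (v i), hfi, 1 + r, ?_, ?_, ?_⟩
    · exact (A i).add_mem (A i).one_mem (sum_mem fun l _ =>
        (A i).mul_mem ((A i).algebraMap_mem _) (pow_mem (huA i) l))
    · rw [← IsLocalRing.notMem_maximalIdeal]
      intro h1
      exact (IsLocalRing.maximalIdeal V').ne_top_iff_one.1 Ideal.IsPrime.ne_top'
        (((IsLocalRing.maximalIdeal V').add_mem_iff_left hrm).1 h1)
    · have h1 : aeval x f = ∑ l ∈ Finset.range (f.natDegree + 1),
          algebraMap V V' ((hasseDeriv l f).eval (v i)) * (x - algebraMap V V' (v i)) ^ l := by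
        rw [← eval_map_algebraMap, ← taylor_eval_sub (algebraMap V V' (v i)) (f.map _) x,
          eval_eq_sum_range, natDegree_taylor, natDegree_map_eq_of_injective hinj]
        simp only [taylor_coeff, hasseDeriv_map, eval_map_apply]
      rw [h1, Finset.range_eq_Ico, Finset.sum_eq_sum_Ico_succ_bot (Nat.succ_pos _), mul_add,
        hr, Finset.mul_sum]
      congr 1
      · simp
      · refine Finset.sum_congr rfl fun l hl => ?_
        have hl0 : l ≠ 0 := by have := (Finset.mem_Ico.1 hl).1; omega
        have h2 := congrArg (algebraMap V V') (he l hl0).2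
        simp only [map_mul, map_pow] at h2
        rw [hu, mul_pow]
        linear_combination u i ^ l * h2
  refine ⟨Set.range fun i => (A i).fractionsInside, Set.range_nonempty _, ?_, ?_, fun b => ?_⟩
  · rintro _ ⟨i, rfl⟩ _ ⟨j, rfl⟩
    exact ⟨_, ⟨max i j, rfl⟩, Subalgebra.fractionsInside_mono (hmono (le_max_left i j)),
      Subalgebra.fractionsInside_mono (hmono (le_max_right i j))⟩
  · rintro _ ⟨i, rfl⟩
    exact ⟨A i, ⟨u i, hdtr i, rfl⟩, (A i).isLocalizationOfSubalgebra_fractionsInside⟩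
  · by_cases hb0 : b = 0
    · obtain ⟨i⟩ := ‹Nonempty ι›
      exact ⟨_, ⟨i, rfl⟩, hb0 ▸ zero_mem _⟩
    obtain ⟨p, q, hq, hpq⟩ : ∃ p q : V[X], q ≠ 0 ∧ b * aeval x q = aeval x p := by
      have hbK : algebraMap V' K' b ∈ IntermediateField.adjoin K {algebraMap V' K' x} := by
        rw [hgen]; trivial
      obtain ⟨p, q, hpq⟩ := (IntermediateField.mem_adjoin_simple_iff K _).1 hbK
      have hq0 : aeval (algebraMap V' K' x) q ≠ 0 := fun h => hb0 (by
        rw [h, div_zero, map_eq_zero_iff _ (IsFractionRing.injective V' K')] at hpq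
        exact hpq)
      obtain ⟨c, hc, hcp⟩ := IsLocalization.integerNormalization_spec (nonZeroDivisors V) p
      obtain ⟨c', hc', hcq⟩ := IsLocalization.integerNormalization_spec (nonZeroDivisors V) q
      set p' := IsLocalization.integerNormalization (nonZeroDivisors V) p
      set q' := IsLocalization.integerNormalization (nonZeroDivisors V) q
      have hp' : algebraMap V' K' (aeval x p') =
          algebraMap V K' c * aeval (algebraMap V' K' x) p := by
        rw [← aeval_algebraMap_apply, ← aeval_map_algebraMap K, hcp,
          ← algebraMap_smul K c p, map_smul, Algebra.smul_def, ← IsScalarTower.algebraMap_apply]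
      have hq' : algebraMap V' K' (aeval x q') =
          algebraMap V K' c' * aeval (algebraMap V' K' x) q := by
        rw [← aeval_algebraMap_apply, ← aeval_map_algebraMap K, hcq,
          ← algebraMap_smul K c' q, map_smul, Algebra.smul_def, ← IsScalarTower.algebraMap_apply]
      refine ⟨C c' * p', C c * q', mul_ne_zero (C_ne_zero.2 (nonZeroDivisors.ne_zero hc)) ?_, ?_⟩
      · rintro h0
        have : q = 0 := by
          rwa [IsLocalization.integerNormalization_eq_zero_iff le_rfl] at h0
        simp [this] at hq0
      · refine IsFractionRing.injective V' K' ?_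
        simp only [map_mul, aeval_C, hp', hq', hpq, ← hVV']
        field_simp
    have hp : p ≠ 0 := by
      rintro rfl
      rw [map_zero, mul_eq_zero, or_iff_right hb0] at hpq
      refine hxtr (IsAlgebraic.extendScalars (IsFractionRing.injective V K) (R := V) ⟨q, hq, ?_⟩)
      rw [aeval_algebraMap_apply, hpq, map_zero]
    obtain ⟨i, ⟨c, hc, t, ht, htu, hpt⟩, ⟨c', hc', t', ht', htu', hqt⟩⟩ :=
      ((key p hp).and (key q hq)).exists
    refine ⟨_, ⟨i, rfl⟩, ?_⟩
    -- the constants `c` and `c'` satisfy `c' ∣ c` already in `V`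
    obtain ⟨e, rfl⟩ : c' ∣ c := by
      refine (hw _ _).1 ?_
      rw [hVV', hVV', valuation_algebraMap_le_iff]
      rw [hpt, hqt] at hpq
      exact (htu.dvd_mul_right).1 ⟨b * t', by rw [← hpq]; ring⟩
    refine ⟨algebraMap V V' e * t, (A i).mul_mem ((A i).algebraMap_mem e) ht, t', ht', htu', ?_⟩
    refine mul_left_cancel₀ ((map_ne_zero_iff _ hinj).2 hc') ?_
    rw [hpt, hqt, map_mul] at hpq
    linear_combination hpq

end PseudoLimit

/-! ### The equivalence -/

theorem theorem3 {V : Type u₁} {V' : Type u₂} {K : Type u₃} {K' : Type u₄}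
    [CommRing V] [IsDomain V] [ValuationRing V]
    [CommRing V'] [IsDomain V'] [ValuationRing V']
    [Field K] [Field K'] [Algebra V K] [IsFractionRing V K] [Algebra V' K'] [IsFractionRing V' K']
    [Algebra V V'] [Algebra K K'] [Algebra V K']
    [IsScalarTower V K K'] [IsScalarTower V V' K']
    (himm : IsImmediateExtension V V' K K')
    (hV : ringKrullDim V = 1 ∨ HenselianLocalRing V)
    {o : Ordinal.{w}} (ho : Order.IsSuccLimit o) (v : Set.Iio o → V)
    (hpc : IsPseudoConvergent (ValuationRing.valuation V K) (fun i => algebraMap V K (v i)))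
    (hnf : ¬ IsFundamental (ValuationRing.valuation V K) (fun i => algebraMap V K (v i)))
    (hnl : ¬ ∃ z : K,
      IsPseudoLimit (ValuationRing.valuation V K) (fun i => algebraMap V K (v i)) z)
    (x : V')
    (hx : IsPseudoLimit (ValuationRing.valuation V' K') (fun i => algebraMap V K' (v i))
      (algebraMap V' K' x))
    (hxtr : Transcendental K (algebraMap V' K' x))
    (hgen : IntermediateField.adjoin K {algebraMap V' K' x} = ⊤) :
    List.TFAE [
      ∀ f : V[X], aeval x f ≠ 0 → ∃ y : V,
        ValuationRing.valuation V' K' (algebraMap V K' (f.eval y)) =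
          ValuationRing.valuation V' K' (algebraMap V' K' (aeval x f)),
      ∀ f : V[X], aeval x f ≠ 0 → ∃ y : V,
        ValuationRing.valuation V' K' (algebraMap V K' (f.eval y)) ≤
          ValuationRing.valuation V' K' (algebraMap V' K' (aeval x f)),
      IsTranscendentalSeq V (ValuationRing.valuation V K) v,
      IsFilteredUnionOfLocalizedPolynomial V V'] := by
  have := himm.isLocalHom
  obtain ⟨e, he⟩ := himm.valueGroup
  have : Nonempty (Set.Iio o) := ⟨⟨⊥, ho.bot_lt⟩⟩
  have : NoMaxOrder (Set.Iio o) :=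
    ⟨fun i => ⟨⟨Order.succ i.1, ho.succ_lt i.2⟩, Order.lt_succ i.1⟩⟩
  have hwK : ∀ a b : K, ValuationRing.valuation V' K' (algebraMap K K' a) ≤
      ValuationRing.valuation V' K' (algebraMap K K' b) ↔
        ValuationRing.valuation V K a ≤ ValuationRing.valuation V K b := fun a b => by
    rw [← he, ← he, map_le_map_iff]
  have hweq : ∀ a b : K, ValuationRing.valuation V' K' (algebraMap K K' a) =
      ValuationRing.valuation V' K' (algebraMap K K' b) ↔
        ValuationRing.valuation V K a = ValuationRing.valuation V K b := fun a b => by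
    rw [le_antisymm_iff, le_antisymm_iff, hwK, hwK]
  have hVK : ∀ a : V, algebraMap V K' a = algebraMap K K' (algebraMap V K a) :=
    IsScalarTower.algebraMap_apply V K K'
  have hVV' : ∀ a : V, algebraMap V K' a = algebraMap V' K' (algebraMap V V' a) :=
    IsScalarTower.algebraMap_apply V V' K'
  have hw : ∀ a b : V, ValuationRing.valuation V' K' (algebraMap V K' a) ≤
      ValuationRing.valuation V' K' (algebraMap V K' b) ↔ b ∣ a := fun a b => by
    rw [hVK, hVK, hwK, ValuationRing.valuation_algebraMap_le_iff]
  have hsurj : ∀ z : K', ∃ a : K, ValuationRing.valuation V' K' (algebraMap K K' a) =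
      ValuationRing.valuation V' K' z := fun z => by
    obtain ⟨a, ha⟩ := Quotient.mk_surjective (e.symm (ValuationRing.valuation V' K' z))
    refine ⟨a, ?_⟩
    rw [← he, ← e.apply_symm_apply (ValuationRing.valuation V' K' z), ← ha]
    rfl
  have hx' : ∀ i j, i < j → ValuationRing.valuation V' K'
      (algebraMap V' K' x - algebraMap V K' (v i)) =
        ValuationRing.valuation V' K' (algebraMap V K' (v i - v j)) := fun i j hij => by
    rw [hx i j hij, map_sub (algebraMap V K')]
  have hanti : StrictAnti fun i => ValuationRing.valuation V' K'
      (algebraMap V' K' x - algebraMap V K' (v i)) := fun i j hij => by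
    obtain ⟨k, hk⟩ := exists_gt j
    simp only
    rw [hx' i k (hij.trans hk), hx' j k hk, lt_iff_le_not_ge, hVK, hVK, hwK, hwK,
      ← lt_iff_le_not_ge, map_sub (algebraMap V K), map_sub (algebraMap V K)]
    exact hpc i j k hij hk
  have hconst : IsTranscendentalSeq V (ValuationRing.valuation V K) v ↔ ∀ f : V[X],
      Filter.EventuallyConst
        (fun i => ValuationRing.valuation V K (algebraMap V K (f.eval (v i)))) Filter.atTop := by
    refine forall_congr' fun f => ?_
    rw [Filter.eventuallyConst_atTop]
    constructor
    · rintro ⟨j, hj⟩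
      refine ⟨j, fun i hi => ?_⟩
      rcases hi.eq_or_lt with rfl | hi
      · rfl
      · exact (hj j i le_rfl hi).symm
    · rintro ⟨j, hj⟩
      exact ⟨j, fun i i' hi hi' => (hj i hi).trans (hj i' (hi.trans hi'.le)).symm⟩
  tfae_have 1 → 2 := fun h f hf => (h f hf).imp fun y hy => hy.le
  tfae_have 2 → 3 := fun h => by
    refine hconst.2 (ValuationRing.eventuallyConst_of_exists_le hV hwK hsurj hxtr hanti hx' ?_ ?_)
    · intro y
      by_contra! hy
      refine hnl ⟨algebraMap V K y, fun i j hij => ?_⟩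
      simp only
      rw [← map_sub, ← map_sub, ← hweq, ← hVK, ← hVK, hy i, hx' i j hij]
    · intro f hf
      rw [aeval_algebraMap_apply] at hf ⊢
      exact h f fun h0 => hf (by rw [h0, map_zero])
  tfae_have 3 → 4 := fun h => by
    refine isFilteredUnionOfLocalizedPolynomial_of_eventuallyConst hw hxtr hgen hanti hx'
      fun f => ?_
    obtain ⟨j, hj⟩ := Filter.eventuallyConst_atTop.1 (hconst.1 h f)
    exact Filter.eventuallyConst_atTop.2 ⟨j, fun i hi => by rw [hVK, hVK, hweq, hj i hi]⟩
  tfae_have 4 → 1 := fun h f hf => by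
    obtain ⟨a, ha⟩ := hsurj (algebraMap V' K' (aeval x f))
    obtain ⟨d, rfl⟩ : ∃ d : V, algebraMap V K d = a := by
      refine (ValuationRing.mem_integer_iff V K a).1 ?_
      rw [Valuation.mem_integer_iff, ← map_one (ValuationRing.valuation V K), ← hwK, ha, map_one,
        map_one]
      exact ValuationRing.valuation_algebraMap_le_one _
    rw [← hVK, hVV'] at ha
    have hd : Associated (algebraMap V V' d) (aeval x f) := associated_of_dvd_dvd
      (ValuationRing.valuation_algebraMap_le_iff.1 ha.ge)
      (ValuationRing.valuation_algebraMap_le_iff.1 ha.le)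
    obtain ⟨y, hy⟩ := h.exists_associated_eval himm.residueField.2 hd
    exact ⟨y, by rw [← ha, ← hVV']; exact le_antisymm ((hw _ _).2 hy.dvd) ((hw _ _).2 hy.symm.dvd)⟩
  tfae_finish
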